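/- Let $E$ be a non-Archimedean local field with ring of integers $\mathfrak{o}_E$, maximal ideal $\mathfrak{p}_E$ and residue field $k_E$, let $V$ be a finite-dimensional $E$-vector space, $B=\mathrm{End}_E V$ and $G_E=\mathrm{Aut}_E V$. A hereditary $\mathfrak{o}_E$-order in $B$ is a ring of the form $\mathfrak{B}=\{y\in B : yL_i\subseteq L_i \text{ for all } i\in\mathbb{Z}\}$, where $(L_i)_{i\in\mathbb{Z}}$ is an $\mathfrak{o}_E$-lattice chain in $V$, i.e. a strictly decreasing sequence of $\mathfrak{o}_E$-lattices for which there is an integer $e\geq 1$ (the period) with $L_{i+e}=\mathfrak{p}_E L_i$ for all $i$. Write $U(\mathfrak{B})=\mathfrak{B}^\times$ and $U^1(\mathfrak{B})=1+\mathfrak{Q}$, where $\mathfrak{Q}$ is the Jacobson radical of $\mathfrak{B}$. The order is principal if $\dim_{k_E}(L_i/L_{i+1})$ does not depend on $i$. All representations are complex. For a representation $\pi$ of a subgroup $H$ of $G_E$ and $x\in G_E$, put $H^x=xHx^{-1}$, and let $\pi^x$ be the representation of $H^x$ given by $\pi^x(xhx^{-1})=\pi(h)$. Let $\mathfrak{B}_0\subseteq\mathfrak{B}$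 be hereditary $\mathfrak{o}_E$-orders in $B$ with $\mathfrak{B}_0$ principal, given by a lattice chain $(L_i^0)$ of period $e_0$ with $\dim_{k_E}(L_i^0/L_{i+1}^0)=f$ for all $i$. Choosing bases of the spaces $L_i^0/L^0_{i+1}$, $0\leq i\leq e_0-1$, identify $U(\mathfrak{B}_0)/U^1(\mathfrak{B}_0)$ with $\prod_{i=0}^{e_0-1}\mathrm{GL}_f(k_E)$. Let $\rho_0$ be an irreducible cuspidal representation of $\mathrm{GL}_f(k_E)$, and let $\rho$ be (a representation isomorphic to) the inflation to $U(\mathfrak{B}_0)$ of the representation $\rho_0^{\otimes e_0}$ of $U(\mathfrak{B}_0)/U^1(\mathfrak{B}_0)$. Let $\tau$ be the inflation to $U(\mathfrak{B})$ of an irreducible representation of $U(\mathfrak{B})/U^1(\mathfrak{B})$. Let $$I_{G_E}(\rho)=\{x\in G_E : \mathrm{Hom}_{U(\mathfrak{B}_0)\cap U(\mathfrak{B}_0)^x}(\rho,\rho^x)\neq 0\}.$$ Then $$\dim\mathrm{Hom}_{U(\mathfrak{B}_0)\cap U(\mathfrak{B})^x}(\rho,\tau^x)=\dim\mathrm{Hom}_{U(\mathfrak{B}_0)}(\rho,\tau)$$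 for all $x\in I_{G_E}(\rho)$. -/

import Mathlib

open ValuativeRel
open scoped MatrixGroups TensorProduct

noncomputable section

namespace HereditaryOrder

/-! ### Groups and representations -/

section Representations

variable {G : Type*} [Group G] {X Y : Type*} [AddCommGroup X] [Module ℂ X]
  [AddCommGroup Y] [Module ℂ Y]

/-- The conjugate `H ^ x = x H x⁻¹` of a subgroup. -/
def conj (H : Subgroup G) (x : G) : Subgroup G := H.map (MulAut.conj x).toMonoidHom

theorem inv_mul_mul_mem_of_mem_conj {H : Subgroup G} {x g : G} (hg : g ∈ conj H x) :
    x⁻¹ * g * x ∈ H := by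
  obtain ⟨h, hh, rfl⟩ := hg
  simpa [mul_assoc] using hh

/-- The conjugate representation `π ^ x` of `H ^ x`, `π ^ x (x h x⁻¹) = π h`, that is,
`π ^ x g = π (x⁻¹ g x)` for `g ∈ H ^ x`. -/
def conjRep {H : Subgroup G} (π : Representation ℂ H X) (x : G) :
    Representation ℂ (conj H x) X where
  toFun g := π ⟨x⁻¹ * g * x, inv_mul_mul_mem_of_mem_conj g.2⟩
  map_one' := by
    rw [← map_one π]; congr 1; ext; simp
  map_mul' g h := by
    rw [← map_mul π]; congr 1; ext; simp [mul_assoc]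

/-- The restriction of a representation of `K` to a subgroup `H ≤ K`. -/
def restrict {H K : Subgroup G} (hHK : H ≤ K) (π : Representation ℂ K X) :
    Representation ℂ H X :=
  π.comp (Subgroup.inclusion hHK)

/-- The complex vector space `Hom_{H ∩ K ^ x}(π, σ ^ x)` for representations `π` of `H`
and `σ` of `K`. -/
abbrev TwistedHom {H K : Subgroup G} (π : Representation ℂ H X) (σ : Representation ℂ K Y)
    (x : G) :=
  Representation.IntertwiningMap
    (restrict (inf_le_left : H ⊓ conj K x ≤ H) π)
    (restrict (inf_le_right : H ⊓ conj K x ≤ conj K x) (conjRep σ x))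

/-- The intertwining set `I_G(π)` of a representation `π` of `H`: all `x` in `G` such that
`Hom_{H ∩ H ^ x}(π, π ^ x) ≠ 0`. -/
def intertwiningSet {H : Subgroup G} (π : Representation ℂ H X) : Set G :=
  {x | ∃ T : TwistedHom π π x, T ≠ 0}

/-- The outer tensor power `π ^ {⊗ e}`, a representation of `G ^ e`. -/
def tensorPower (π : Representation ℂ G X) (e : ℕ) :
    Representation ℂ (Fin e → G) (⨂[ℂ] _ : Fin e, X) :=
  (PiTensorProduct.mapMonoidHom (R := ℂ) (s := fun _ : Fin e ↦ X)).comp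
    (MonoidHom.pi fun i ↦ π.comp (Pi.evalMonoidHom (fun _ : Fin e ↦ G) i))

end Representations

/-! ### Cuspidal representations of `GL_f` over a field -/

section Cuspidal

variable {k : Type*} [Field k] {f : ℕ}

/-- The unipotent radical of the parabolic subgroup
`{g | ∀ i j, g i j ≠ 0 → c i ≤ c j}` of `GL_f(k)`. -/
def unipotentRadical (c : Fin f → ℕ) : Set (GL (Fin f) k) :=
  {g | ∀ i j, (g : Matrix (Fin f) (Fin f) k) i j ≠ (1 : Matrix (Fin f) (Fin f) k) i j →
    c i < c j}

/-- An irreducible representation of `GL_f(k)` (`k` finite) is cuspidal if the unipotent radical of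
each proper parabolic subgroup fixes only the zero vector. Here the parabolic subgroups run through
those that contain the diagonal torus; every parabolic subgroup is conjugate to one of these.
The parabolic subgroup attached to `c` is proper if and only if `c` is not constant. -/
structure IsCuspidal {W : Type*} [AddCommGroup W] [Module ℂ W]
    (π : Representation ℂ (GL (Fin f) k) W) : Prop where
  irreducible : π.IsIrreducible
  eq_zero_of_fixed : ∀ c : Fin f → ℕ, (∃ i j, c i ≠ c j) →
    ∀ w : W, (∀ g ∈ unipotentRadical (k := k) c, π g w = w) → w = 0

end Cuspidal

/-! ### Unit groups -/

section Units

variable {A : Type*} [Ring A]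

/-- `U(𝔅) = 𝔅ˣ`, as a subgroup of `Aˣ`. -/
abbrev U (𝔅 : Subring A) : Subgroup Aˣ := 𝔅.toSubmonoid.units

/-- The isomorphism of `U(𝔅)` with the group of units of the ring `𝔅`. -/
def unitsEquiv (𝔅 : Subring A) : U 𝔅 ≃* 𝔅ˣ := 𝔅.toSubmonoid.unitsEquivUnitsType

/-- `U¹(𝔅) = 1 + 𝔔`, where `𝔔` is the Jacobson radical of `𝔅`, as a (normal) subgroup of `U(𝔅)`:
the kernel of `U(𝔅) → (𝔅 / 𝔔)ˣ`. -/
def U1 (𝔅 : Subring A) : Subgroup (U 𝔅) :=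
  ((Units.map (Ideal.Quotient.mk (Ring.jacobson 𝔅) : 𝔅 →* 𝔅 ⧸ Ring.jacobson 𝔅)).comp
    (unitsEquiv 𝔅).toMonoidHom).ker

instance (𝔅 : Subring A) : (U1 𝔅).Normal := MonoidHom.normal_ker _

theorem mem_U1_iff (𝔅 : Subring A) (u : U 𝔅) :
    u ∈ U1 𝔅 ↔ ((unitsEquiv 𝔅 u : 𝔅ˣ) : 𝔅) - 1 ∈ Ring.jacobson 𝔅 := by
  rw [U1, MonoidHom.mem_ker, ← Ideal.Quotient.eq, Units.ext_iff]
  rfl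

/-- Inflation to `U(𝔅)` of a representation of `U(𝔅) / U¹(𝔅)`. -/
def inflate (𝔅 : Subring A) {X : Type*} [AddCommGroup X] [Module ℂ X]
    (π : Representation ℂ (U 𝔅 ⧸ U1 𝔅) X) : Representation ℂ (U 𝔅) X :=
  π.comp (QuotientGroup.mk' (U1 𝔅))

end Units

/-! ### Lattice chains and hereditary orders -/

variable (E : Type*) [Field E] [ValuativeRel E] [TopologicalSpace E]
  [IsNonarchimedeanLocalField E] (V : Type*) [AddCommGroup V] [Module E V]

/-- An `𝔬_E`-lattice chain in `V`: a strictly decreasing sequence `(L_i)`, `i ∈ ℤ`, of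
`𝔬_E`-lattices in `V` with `L_{i + e} = 𝔭_E L_i` for all `i`, where `e ≥ 1` is the period. -/
structure LatticeChain where
  /-- the lattices `L_i` -/
  L : ℤ → Submodule 𝒪[E] V
  /-- the `𝔬_E`-period `e` -/
  period : ℕ
  isLattice : ∀ i, (L i).IsLattice E
  strictAnti : StrictAnti L
  period_pos : 0 < period
  periodic : ∀ i, L (i + period) = 𝓂[E] • L i

variable {E V}

namespace LatticeChain

variable (Λ : LatticeChain E V)

/-- The order `End⁰(L) = {x ∈ End_E V | x L_i ⊆ L_i for all i}`. -/
def order : Subring (Module.End E V) where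
  carrier := {x | ∀ i, ∀ v ∈ Λ.L i, x v ∈ Λ.L i}
  mul_mem' hx hy i v hv := hx i _ (hy i v hv)
  one_mem' _ _ hv := hv
  add_mem' hx hy i v hv := add_mem (hx i v hv) (hy i v hv)
  zero_mem' i _ _ := zero_mem (Λ.L i)
  neg_mem' hx i v hv := neg_mem (hx i v hv)

/-- The `k_E`-vector space `L_i / L_{i + 1}`, as an `𝔬_E`-module. -/
abbrev Gr (i : ℤ) : Type _ := Λ.L i ⧸ (Λ.L (i + 1)).submoduleOf (Λ.L i)

/-- The endomorphism of `L_i` induced by an element of `End⁰(L)`. -/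
def latticeEnd (i : ℤ) (x : Λ.order) : Module.End 𝒪[E] (Λ.L i) :=
  ((x : Module.End E V).restrictScalars 𝒪[E]).restrict (x.2 i)

/-- The action of `End⁰(L)` on `L_i / L_{i + 1}`. -/
def grEnd (i : ℤ) : Λ.order →* Module.End 𝒪[E] (Λ.Gr i) where
  toFun x := Submodule.mapQ _ _ (Λ.latticeEnd i x) fun v hv ↦ x.2 (i + 1) v hv
  map_one' := by
    ext v
    rfl
  map_mul' x y := by
    ext v
    rfl

theorem algebraMap_residue_surjective : Function.Surjective (algebraMap 𝒪[E] 𝓀[E]) :=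
  IsLocalRing.residue_surjective

/-- Given an identification `L_i / L_{i + 1} ≅ k_E ^ f`, the matrix over `k_E` by which an element
of `End⁰(L)` acts on `L_i / L_{i + 1}`. -/
def blockMatrix {f : ℕ} {i : ℤ} (φ : Λ.Gr i ≃ₗ[𝒪[E]] (Fin f → 𝓀[E])) :
    Λ.order →* Matrix (Fin f) (Fin f) 𝓀[E] where
  toFun x := LinearMap.toMatrix'
    ((φ.conj (Λ.grEnd i x)).extendScalarsOfSurjective algebraMap_residue_surjective)
  map_one' := by
    rw [← LinearMap.toMatrix'_one]
    congr 1
    ext v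
    simp [LinearEquiv.conj_apply]
  map_mul' x y := by
    rw [← LinearMap.toMatrix'_mul]
    congr 1
    ext v
    simp [LinearEquiv.conj_apply]

/-- `blockMatrix φ x` is characterized by `φ (x v) = blockMatrix φ x * φ v`. -/
theorem blockMatrix_mulVec {f : ℕ} {i : ℤ} (φ : Λ.Gr i ≃ₗ[𝒪[E]] (Fin f → 𝓀[E]))
    (x : Λ.order) (v : Λ.Gr i) :
    (Λ.blockMatrix φ x).mulVec (φ v) = φ (Λ.grEnd i x v) := by
  change (LinearMap.toMatrix' _).mulVec (φ v) = _
  rw [LinearMap.toMatrix'_mulVec]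
  simp [LinearEquiv.conj_apply]

/-- The homomorphism `U(End⁰(L)) → GL_f(k_E)` given by the action on `L_i / L_{i + 1} ≅ k_E ^ f`. -/
def blockReduction {f : ℕ} {i : ℤ} (φ : Λ.Gr i ≃ₗ[𝒪[E]] (Fin f → 𝓀[E])) :
    U Λ.order →* GL (Fin f) 𝓀[E] :=
  (Units.map (Λ.blockMatrix φ)).comp (unitsEquiv Λ.order).toMonoidHom

/-- A lattice chain is uniform, with common value `f`, if `dim_{k_E} (L_i / L_{i + 1}) = f` for all
`i`; the hereditary order `End⁰(L)` is then called principal. A framing is a choice of bases of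
`L_i / L_{i + 1}`, `0 ≤ i ≤ e - 1`. By periodicity of the chain, a framing exists if and only if
the chain is uniform with common value `f`. -/
abbrev Framing (f : ℕ) : Type _ :=
  ∀ i : Fin Λ.period, Λ.Gr ((i : ℕ) : ℤ) ≃ₗ[𝒪[E]] (Fin f → 𝓀[E])

/-- The projection `U(𝔅₀) → U(𝔅₀) / U¹(𝔅₀) ≅ ∏_{0 ≤ i ≤ e - 1} GL_f(k_E)` of the
principal order `𝔅₀ = End⁰(L)`, for a choice of bases of the `L_i / L_{i + 1}`. -/
def reduction {f : ℕ} (φ : Λ.Framing f) : U Λ.order →* (Fin Λ.period → GL (Fin f) 𝓀[E]) :=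
  MonoidHom.pi fun i ↦ Λ.blockReduction (φ i)

/-- The inflation to `U(𝔅₀)` of the representation `ρ₀ ^ {⊗ e}` of
`U(𝔅₀) / U¹(𝔅₀) ≅ ∏_{0 ≤ i ≤ e - 1} GL_f(k_E)`. -/
def inflateTensorPower {f : ℕ} (φ : Λ.Framing f) {W : Type*} [AddCommGroup W] [Module ℂ W]
    (ρ₀ : Representation ℂ (GL (Fin f) 𝓀[E]) W) :
    Representation ℂ (U Λ.order) (⨂[ℂ] _ : Fin Λ.period, W) :=
  (tensorPower ρ₀ Λ.period).comp (Λ.reduction φ)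

end LatticeChain

/-- A hereditary `𝔬_E`-order in `End_E V`: the stabilizer `End⁰(L)` of an `𝔬_E`-lattice chain. -/
def IsHereditaryOrder (𝔅 : Subring (Module.End E V)) : Prop :=
  ∃ Λ : LatticeChain E V, Λ.order = 𝔅

end HereditaryOrder

end

/-!
The two spaces are compared by replacing `x` with a well chosen element `w` of `x U(𝔅)`, for which
`Hom_{U(𝔅₀) ∩ U(𝔅) ^ w}(ρ, τ ^ w)` can be identified with `Hom_{U(𝔅₀)}(ρ, τ)` by hand.

*Relative position.* Two lattice chains always have a common splitting basis (`exists_splits`). For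
the chain `L` of `𝔅₀` and its translate `x L` this gives a basis `b (j, a)`, with `0 ≤ j < e` and
`0 ≤ a < f`, in which `b (j, a)` has degree `j` with respect to `L` and some degree `β (j, a)` with
respect to `x L` (`exists_adapted_basis`). If `β (j, ·)` were not constant for some `j`, then `x L`
would induce a proper flag on `L_j / L_{j + 1}`. The elements of the unipotent radical of its
stabilizer lift to elements of `U(𝔅₀)` that act trivially under `ρ ^ x`
(`LatticeChain.exists_unipotent_lift`). An operator in `Hom(ρ, ρ ^ x)` therefore factors through the
coinvariants of this unipotent radical, which are zero as `ρ₀` is cuspidal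
(`IsCuspidal.eq_zero_of_invariant`). So for `x` in the intertwining set of `ρ`, the degree
`β (j, a) = π j` depends only on `j`, and `π` extends to a permutation of `ℤ` commuting with the
translation by `e` (`LatticeChain.exists_permutation_of_degree_eq`).

*Choice of `w`.* The chain of `𝔅` consists of some of the lattices of `L`, because the only lattices
stable under `𝔅₀` are those of `L` (`LatticeChain.exists_isCoarsening`). It divides `ℤ` into
intervals, the blocks. Changing `π` inside the blocks of its values amounts to multiplying the
corresponding monomial automorphism by an element of `U(𝔅)`. Sorting yields a permutation `q` that
is increasing as long as its values stay in one block (`exists_sorted_permutation`). The monomial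
automorphism `w` attached to `q⁻¹` then has the following properties.

* `U(𝔅₀) ∩ U(𝔅) ^ w` is contained in `U(𝔅₀) ^ w` (`LatticeChain.IsCoarsening.conj_mem_order`).
* `U(𝔅₀) ^ w` is contained in `(U(𝔅₀) ∩ U(𝔅₀) ^ w) U¹(𝔅) ^ w`
  (`LatticeChain.IsCoarsening.exists_conj_mul`), and `U¹(𝔅)` acts trivially under `ρ` and under `τ`.
* On `U(𝔅₀) ∩ U(𝔅₀) ^ w`, the representations `ρ` and `ρ ^ w` differ by a permutation of the tensor
  factors (`LatticeChain.reduction_conj_permUnit`, `reindex_tensorPower`), so they are isomorphic.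

These three properties imply the equality of dimensions (`rank_twistedHom_eq`).
-/

noncomputable section

namespace HereditaryOrder

/-! ### The normalized valuation of a local field -/

section Ord

variable {E : Type*} [Field E] [ValuativeRel E] [TopologicalSpace E]
  [IsNonarchimedeanLocalField E]

/-- The normalized additive valuation of `E`, with the junk value `ord 0 = 0`. -/
def ord (c : E) : ℤ :=
  -WithZero.log (IsNonarchimedeanLocalField.valueGroupWithZeroIsoInt E (valuation E c))

theorem isoInt_valuation_ne_zero {c : E} (hc : c ≠ 0) :
    IsNonarchimedeanLocalField.valueGroupWithZeroIsoInt E (valuation E c) ≠ 0 := by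
  simpa using hc

theorem ord_mul {c d : E} (hc : c ≠ 0) (hd : d ≠ 0) : ord (c * d) = ord c + ord d := by
  rw [ord, map_mul, map_mul,
    WithZero.log_mul (isoInt_valuation_ne_zero hc) (isoInt_valuation_ne_zero hd), ord, ord]
  ring

theorem ord_zpow (c : E) (n : ℤ) : ord (c ^ n) = n * ord c := by
  rw [ord, map_zpow₀, map_zpow₀, WithZero.log_zpow, ord, smul_eq_mul]
  ring

theorem ord_le_ord_iff {c d : E} (hc : c ≠ 0) (hd : d ≠ 0) :
    ord c ≤ ord d ↔ valuation E d ≤ valuation E c := by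
  rw [ord, ord, neg_le_neg_iff,
    WithZero.log_le_log (isoInt_valuation_ne_zero hd) (isoInt_valuation_ne_zero hc)]
  exact map_le_map_iff _

theorem ord_one : ord (1 : E) = 0 := by
  simp [ord]

theorem mem_integer_iff_ord {c : E} (hc : c ≠ 0) : c ∈ 𝒪[E] ↔ 0 ≤ ord c := by
  rw [← ord_one (E := E), ord_le_ord_iff one_ne_zero hc, map_one]
  rfl

theorem mem_maximalIdeal_iff_ord {c : 𝒪[E]} (hc : (c : E) ≠ 0) :
    c ∈ 𝓂[E] ↔ 0 < ord (c : E) := by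
  rw [IsLocalRing.mem_maximalIdeal, mem_nonunits_iff,
    Valuation.Integer.not_isUnit_iff_valuation_lt_one, ← not_le, ← not_le, not_iff_not,
    ← map_one (valuation E), ← ord_one (E := E), ord_le_ord_iff hc one_ne_zero]

variable (E) in
theorem exists_ord_eq_one : ∃ c : E, c ≠ 0 ∧ ord c = 1 := by
  obtain ⟨g, hg⟩ := (IsNonarchimedeanLocalField.valueGroupWithZeroIsoInt E).surjective
    (WithZero.exp (-1))
  change IsNonarchimedeanLocalField.valueGroupWithZeroIsoInt E g = _ at hg
  obtain ⟨c, rfl⟩ := valuation_surjective g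
  refine ⟨c, fun h ↦ ?_, ?_⟩
  · rw [h, map_zero, map_zero] at hg
    exact WithZero.exp_ne_zero hg.symm
  · rw [ord, hg, WithZero.log_exp, neg_neg]

variable (E) in
/-- A uniformizer of `E`. -/
def unif : E := (exists_ord_eq_one E).choose

theorem unif_ne_zero : unif E ≠ 0 := (exists_ord_eq_one E).choose_spec.1

theorem ord_unif : ord (unif E) = 1 := (exists_ord_eq_one E).choose_spec.2

theorem ord_unif_zpow (n : ℤ) : ord (unif E ^ n) = n := by
  rw [ord_zpow, ord_unif, mul_one]

variable (E) in
/-- The fractional ideal `{c | e * ord c ≥ k}`, that is, `𝔭 ^ ⌈k / e⌉`. -/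
def fracIdeal (e : ℕ) (k : ℤ) : Submodule 𝒪[E] E where
  carrier := {c | c = 0 ∨ k ≤ e * ord c}
  zero_mem' := Or.inl rfl
  add_mem' {c d} hc hd := by
    by_cases h0 : c + d = 0
    · exact Or.inl h0
    rcases hc with rfl | hc
    · simpa using hd
    rcases hd with rfl | hd
    · simpa using Or.inr hc
    by_cases hc0 : c = 0
    · subst hc0
      simpa using Or.inr hd
    by_cases hd0 : d = 0
    · subst hd0
      simpa using Or.inr hc
    right
    rcases le_max_iff.mp (Valuation.map_add (valuation E) c d) with h | h
    · rw [← ord_le_ord_iff hc0 h0] at h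
      exact hc.trans (by gcongr)
    · rw [← ord_le_ord_iff hd0 h0] at h
      exact hd.trans (by gcongr)
  smul_mem' a c hc := by
    rcases hc with rfl | hc
    · exact Or.inl (smul_zero a)
    by_cases ha0 : (a : E) = 0
    · left
      rw [Subring.smul_def, ha0, zero_smul]
    by_cases hc0 : c = 0
    · left
      rw [hc0, smul_zero]
    right
    rw [Subring.smul_def, smul_eq_mul, ord_mul ha0 hc0]
    have := (mem_integer_iff_ord ha0).mp a.2
    exact hc.trans (by gcongr; linarith)

theorem mem_fracIdeal {e : ℕ} {k : ℤ} {c : E} :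
    c ∈ fracIdeal E e k ↔ c = 0 ∨ k ≤ e * ord c := Iff.rfl

theorem fracIdeal_antitone (e : ℕ) : Antitone (fracIdeal E e) :=
  fun _ _ h _ hc ↦ hc.imp_right h.trans

theorem mul_mem_fracIdeal {e : ℕ} {k l : ℤ} {c d : E} (hc : c ∈ fracIdeal E e k)
    (hd : d ∈ fracIdeal E e l) : c * d ∈ fracIdeal E e (k + l) := by
  by_cases hc0 : c = 0
  · exact Or.inl (by rw [hc0, zero_mul])
  by_cases hd0 : d = 0
  · exact Or.inl (by rw [hd0, mul_zero])
  have h1 := hc.resolve_left hc0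
  have h2 := hd.resolve_left hd0
  right
  rw [ord_mul hc0 hd0, mul_add]
  exact add_le_add h1 h2

theorem unif_zpow_mem_fracIdeal (e : ℕ) (n : ℤ) : unif E ^ n ∈ fracIdeal E e (e * n) := by
  right
  rw [ord_unif_zpow]

theorem unif_zpow_mul_mem_fracIdeal_iff {e : ℕ} {k n : ℤ} {c : E} :
    unif E ^ n * c ∈ fracIdeal E e k ↔ c ∈ fracIdeal E e (k - e * n) := by
  constructor
  · intro h
    have := mul_mem_fracIdeal (unif_zpow_mem_fracIdeal e (-n)) h
    rw [← mul_assoc, ← zpow_add₀ unif_ne_zero, neg_add_cancel, zpow_zero, one_mul] at this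
    convert this using 2
    ring
  · intro h
    have := mul_mem_fracIdeal (unif_zpow_mem_fracIdeal e n) h
    convert this using 2
    ring

theorem mem_fracIdeal_zero_iff {e : ℕ} (he : 0 < e) {c : E} :
    c ∈ fracIdeal E e 0 ↔ c ∈ 𝒪[E] := by
  by_cases hc : c = 0
  · simp [hc]
  rw [mem_integer_iff_ord hc, mem_fracIdeal]
  simp only [hc, false_or]
  have : (0 : ℤ) < e := by exact_mod_cast he
  exact mul_nonneg_iff_of_pos_left this

theorem one_mem_fracIdeal_zero (e : ℕ) : (1 : E) ∈ fracIdeal E e 0 :=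
  Or.inr (by simp [ord_one])

/-- For `0 < k ≤ e`, the ideal `fracIdeal E e k` is the maximal ideal. -/
theorem mem_fracIdeal_iff_mem_maximalIdeal {e : ℕ} {k : ℤ} (hk : 0 < k) (hke : k ≤ e)
    {c : 𝒪[E]} : (c : E) ∈ fracIdeal E e k ↔ c ∈ 𝓂[E] := by
  by_cases hc : (c : E) = 0
  · have : c = 0 := Subtype.ext hc
    simp [this]
  rw [mem_maximalIdeal_iff_ord hc, mem_fracIdeal]
  simp only [hc, false_or]
  constructor
  · intro h
    have h1 : (0 : ℤ) < e * ord (c : E) := hk.trans_le h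
    exact pos_of_mul_pos_right h1 (by positivity)
  · intro h
    nlinarith

theorem unif_mem_integer : unif E ∈ 𝒪[E] := by
  rw [mem_integer_iff_ord unif_ne_zero, ord_unif]
  exact zero_le_one

/-- A nonzero scalar is an integral unit times a power of the uniformizer. -/
theorem eq_unif_zpow_mul {c : E} (hc : c ≠ 0) :
    ∃ u : 𝒪[E], c = unif E ^ ord c * u ∧ ord (u : E) = 0 := by
  have h0 : unif E ^ (-ord c) ≠ 0 := zpow_ne_zero _ unif_ne_zero
  have h : ord (unif E ^ (-ord c) * c) = 0 := by
    rw [ord_mul h0 hc, ord_unif_zpow]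
    ring
  refine ⟨⟨unif E ^ (-ord c) * c, ?_⟩, ?_, h⟩
  · rw [mem_integer_iff_ord (mul_ne_zero h0 hc), h]
  · rw [← mul_assoc, ← zpow_add₀ unif_ne_zero, add_neg_cancel, zpow_zero, one_mul]

end Ord

/-! ### Periodic filtrations of a vector space by finitely generated modules -/

theorem exists_fg_le {R M' : Type*} [Ring R] [AddCommGroup M'] [Module R M']
    {L : ℤ → Submodule R M'} (hL : Antitone L) (hex : ∀ v, ∃ i, v ∈ L i)
    {M : Submodule R M'} (hM : M.FG) : ∃ i, M ≤ L i := by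
  induction M, hM using Submodule.fg_induction with
  | singleton v =>
    obtain ⟨i, hi⟩ := hex v
    exact ⟨i, (Submodule.span_singleton_le_iff_mem _ _).mpr hi⟩
  | sup M N _ _ hM hN =>
    obtain ⟨i, hi⟩ := hM
    obtain ⟨j, hj⟩ := hN
    exact ⟨min i j, sup_le (hi.trans (hL (min_le_left _ _))) (hj.trans (hL (min_le_right _ _)))⟩

variable {E : Type*} [Field E] [ValuativeRel E] [TopologicalSpace E]
  [IsNonarchimedeanLocalField E] {V : Type*} [AddCommGroup V] [Module E V]

/-- A decreasing exhaustive filtration of `V` by finitely generated `𝔬_E`-modules with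
`L_{i + e} = 𝔭_E L_i`. In contrast to a lattice chain, it need not be strictly decreasing, so that
it can be restricted to subspaces. -/
structure IsFiltration (e : ℕ) (L : ℤ → Submodule 𝒪[E] V) : Prop where
  pos : 0 < e
  antitone : Antitone L
  fg : ∀ i, (L i).FG
  unif_smul_mem : ∀ i v, unif E • v ∈ L (i + e) ↔ v ∈ L i
  exhaust : ∀ v, ∃ i, v ∈ L i

theorem zpow_smul_mem_iff {e : ℕ} {L : ℤ → Submodule 𝒪[E] V}
    (hL : ∀ i v, unif E • v ∈ L (i + e) ↔ v ∈ L i) (n : ℤ) (i : ℤ) (v : V) :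
    unif E ^ n • v ∈ L (i + e * n) ↔ v ∈ L i := by
  induction n using Int.induction_on with
  | zero => simp
  | succ n ih =>
    rw [← ih, ← hL (i + e * n), smul_smul, ← zpow_one_add₀ unif_ne_zero]
    ring_nf
  | pred n ih =>
    rw [← ih, ← hL (i + e * (-n - 1)), smul_smul, ← zpow_one_add₀ unif_ne_zero]
    ring_nf

namespace IsFiltration

variable {e : ℕ} {L : ℤ → Submodule 𝒪[E] V} (hL : IsFiltration e L)

include hL

theorem zpow_smul_mem (n : ℤ) (i : ℤ) (v : V) :
    unif E ^ n • v ∈ L (i + e * n) ↔ v ∈ L i :=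
  zpow_smul_mem_iff hL.unif_smul_mem n i v

theorem smul_mem {c : E} {k i : ℤ} {v : V} (hc : c ∈ fracIdeal E e k) (hv : v ∈ L i) :
    c • v ∈ L (i + k) := by
  by_cases hc0 : c = 0
  · rw [hc0, zero_smul]
    exact zero_mem _
  obtain ⟨u, hu, -⟩ := eq_unif_zpow_mul hc0
  have h1 : u • v ∈ L i := (L i).smul_mem u hv
  rw [hu, mul_smul]
  have h2 := (hL.zpow_smul_mem (ord c) i _).mpr h1
  exact hL.antitone (add_le_add_right (hc.resolve_left hc0) i) h2

theorem exists_notMem {v : V} (hv : v ≠ 0) : ∃ i, v ∉ L i := by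
  by_contra! h
  obtain ⟨l, hl⟩ := not_forall.mp (mt (Module.forall_dual_apply_eq_zero_iff E v).mp hv)
  obtain ⟨i, hi⟩ := exists_fg_le (fracIdeal_antitone (E := E) 1)
    (fun c ↦ ⟨ord c, Or.inr (by simp)⟩) ((hL.fg 0).map (l.restrictScalars 𝒪[E]))
  -- the line through `v` has unbounded image under `l`, but the image of `L 0` is bounded
  have h1 : unif E ^ (i - 1 - ord (l v)) • v ∈ L 0 := by
    have := (hL.zpow_smul_mem (i - 1 - ord (l v)) (-(e * (i - 1 - ord (l v)))) v).mpr (h _)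
    rwa [neg_add_cancel] at this
  have h2 := hi (Submodule.mem_map_of_mem h1)
  have h3 : unif E ^ (i - 1 - ord (l v)) ≠ 0 := zpow_ne_zero _ unif_ne_zero
  rw [LinearMap.coe_restrictScalars, map_smul, smul_eq_mul, mem_fracIdeal, ord_mul h3 hl,
    ord_unif_zpow] at h2
  rcases h2 with h2 | h2
  · exact mul_ne_zero h3 hl h2
  · push_cast at h2
    linarith

theorem isLattice (i : ℤ) : (L i).IsLattice E where
  fg := hL.fg i
  span_eq_top := by
    rw [eq_top_iff]
    intro v _
    obtain ⟨j, hj⟩ := hL.exhaust v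
    have he : (1 : ℤ) ≤ e := by exact_mod_cast hL.pos
    have h1 := (hL.zpow_smul_mem |i - j| j v).mpr hj
    have h2 : unif E ^ |i - j| • v ∈ L i := by
      refine hL.antitone ?_ h1
      have : |i - j| ≤ e * |i - j| := le_mul_of_one_le_left (abs_nonneg _) he
      linarith [le_abs_self (i - j)]
    have h3 := (Submodule.span E (L i : Set V)).smul_mem (unif E ^ (-|i - j|))
      (Submodule.subset_span h2)
    rwa [smul_smul, ← zpow_add₀ unif_ne_zero, neg_add_cancel, zpow_zero, one_smul] at h3

theorem maximalIdeal_smul_mem {a : 𝒪[E]} (ha : a ∈ 𝓂[E]) {i : ℤ} {v : V} (hv : v ∈ L i) :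
    a • v ∈ L (i + e) :=
  hL.smul_mem
    ((mem_fracIdeal_iff_mem_maximalIdeal (by exact_mod_cast hL.pos) le_rfl).mpr ha) hv

/-- A vector `v` in `L j` but not in `L (j + 1)` splits off: there is a linear functional `l` with
`l v = 1` whose values on the filtration are as small as those forced by `v`. It is obtained by
lifting a linear functional on the `k_E`-vector space `L j / L (j + 1)` to the free module `L j`. -/
theorem exists_functional {j : ℤ} {v : V} (hv : v ∈ L j) (hv' : v ∉ L (j + 1)) :
    ∃ l : V →ₗ[E] E, l v = 1 ∧ ∀ m, ∀ u ∈ L m, l u ∈ fracIdeal E e (m - j) := by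
  have hlat := hL.isLattice j
  let Q := L j ⧸ (L (j + 1)).submoduleOf (L j)
  have htors : Module.IsTorsionBySet 𝒪[E] Q (𝓂[E] : Ideal 𝒪[E]) := by
    intro q a
    obtain ⟨u, rfl⟩ := Submodule.Quotient.mk_surjective _ q
    rw [← Submodule.Quotient.mk_smul, Submodule.Quotient.mk_eq_zero]
    refine hL.antitone ?_ (hL.maximalIdeal_smul_mem a.2 u.2)
    have : (1 : ℤ) ≤ e := by exact_mod_cast hL.pos
    gcongr
  let : Module 𝓀[E] Q := htors.module
  have : IsScalarTower 𝒪[E] 𝓀[E] Q := htors.isScalarTower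
  have hq : (Submodule.Quotient.mk ⟨v, hv⟩ : Q) ≠ 0 := by
    rw [Ne, Submodule.Quotient.mk_eq_zero]
    exact hv'
  obtain ⟨f, hf⟩ := not_forall.mp (mt (Module.forall_dual_apply_eq_zero_iff 𝓀[E] _).mp hq)
  obtain ⟨g, hg⟩ := Module.projective_lifting_property (P := L j)
    (Algebra.linearMap 𝒪[E] 𝓀[E]) ((f.restrictScalars 𝒪[E]) ∘ₗ Submodule.mkQ _)
    IsLocalRing.residue_surjective
  have hg' : ∀ u, IsLocalRing.residue 𝒪[E] (g u) = f (Submodule.Quotient.mk u) :=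
    fun u ↦ LinearMap.congr_fun hg u
  let b := Module.Free.chooseBasis 𝒪[E] (L j)
  let B := b.extendOfIsLattice E
  let l : V →ₗ[E] E := B.constr E fun i ↦ (g (b i) : E)
  have hl : ∀ u : L j, l u = (g u : E) := by
    intro u
    have : (l.restrictScalars 𝒪[E]) ∘ₗ (L j).subtype
        = (Algebra.linearMap 𝒪[E] E) ∘ₗ g := by
      refine b.ext fun i ↦ ?_
      have h1 : B i = (b i : V) := Module.Basis.extendOfIsLattice_apply E b i
      change l (b i : V) = _
      rw [← h1, Module.Basis.constr_basis]
      rfl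
    exact LinearMap.congr_fun this u
  have hunit : g ⟨v, hv⟩ ∉ 𝓂[E] := by
    rw [← IsLocalRing.residue_eq_zero_iff, hg']
    exact hf
  have hlv : ord (l v) = 0 ∧ l v ≠ 0 := by
    have h0 := hl ⟨v, hv⟩
    change l v = _ at h0
    have h1 : (g ⟨v, hv⟩ : E) ≠ 0 := fun h ↦ hunit (by
      rw [show g ⟨v, hv⟩ = 0 from Subtype.ext h]
      exact zero_mem _)
    rw [mem_maximalIdeal_iff_ord h1, not_lt] at hunit
    rw [h0]
    exact ⟨le_antisymm hunit ((mem_integer_iff_ord h1).mp (g ⟨v, hv⟩).2), h1⟩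
  -- on `L (j + 1)` the functional takes values in the maximal ideal
  have hj1 : ∀ u ∈ L (j + 1), l u ∈ fracIdeal E e e := by
    intro u hu
    have hu' : u ∈ L j := hL.antitone (by simp) hu
    rw [hl ⟨u, hu'⟩, mem_fracIdeal_iff_mem_maximalIdeal (by exact_mod_cast hL.pos) le_rfl,
      ← IsLocalRing.residue_eq_zero_iff, hg']
    have : (Submodule.Quotient.mk ⟨u, hu'⟩ : Q) = 0 := by
      rw [Submodule.Quotient.mk_eq_zero]
      exact hu
    rw [this, map_zero]
  have he : (0 : ℤ) < e := by exact_mod_cast hL.pos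
  have key : ∀ m, ∀ u ∈ L m, l u ∈ fracIdeal E e (m - j) := by
    intro m u hu
    -- shift `m` into the range `j + 1, …, j + e`
    obtain ⟨k, r, hr0, hre, hm⟩ : ∃ k r : ℤ, 0 ≤ r ∧ r < e ∧ m = j + 1 + r + e * k :=
      ⟨(m - j - 1) / e, (m - j - 1) % e, Int.emod_nonneg _ he.ne', Int.emod_lt_of_pos _ he, by
        linarith [Int.emod_add_mul_ediv (m - j - 1) e]⟩
    have h1 : unif E ^ (-k) • u ∈ L (j + 1 + r) := by
      have := (hL.zpow_smul_mem (-k) m u).mpr hu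
      convert this using 2
      rw [hm]
      ring
    have h2 := hj1 _ (hL.antitone (by linarith) h1)
    rw [map_smul, smul_eq_mul, unif_zpow_mul_mem_fracIdeal_iff] at h2
    refine fracIdeal_antitone e ?_ h2
    rw [hm]
    linarith
  refine ⟨(l v)⁻¹ • l, ?_, fun m u hu ↦ ?_⟩
  · simp [hlv.2]
  · have h1 : (l v)⁻¹ ∈ fracIdeal E e 0 := by
      right
      rw [← zpow_neg_one, ord_zpow, hlv.1]
      simp
    have := mul_mem_fracIdeal h1 (key m u hu)
    rwa [zero_add] at this

end IsFiltration

/-! ### Bases splitting one or two filtrations -/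

/-- The basis `b`, with `b t` placed in degree `α t`, splits the filtration `L`: a vector lies in
`L j` if and only if each of its components does. -/
def Splits (e : ℕ) (L : ℤ → Submodule 𝒪[E] V) {ι : Type*} (b : Module.Basis ι E V) (α : ι → ℤ) :
    Prop :=
  ∀ j v, v ∈ L j ↔ ∀ t, b.repr v t ∈ fracIdeal E e (j - α t)

theorem IsFiltration.comap {e : ℕ} {L : ℤ → Submodule 𝒪[E] V} (hL : IsFiltration e L)
    {U : Type*} [AddCommGroup U] [Module E U] (g : U →ₗ[E] V) (hg : Function.Injective g) :
    IsFiltration e fun i ↦ (L i).comap (g.restrictScalars 𝒪[E]) where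
  pos := hL.pos
  antitone _ _ h := Submodule.comap_mono (hL.antitone h)
  fg i := by
    apply Submodule.fg_of_fg_map_injective (g.restrictScalars 𝒪[E]) hg
    exact (hL.fg i).of_le (Submodule.map_comap_le _ _)
  unif_smul_mem i v := by
    simp only [Submodule.mem_comap, LinearMap.coe_restrictScalars, map_smul]
    exact hL.unif_smul_mem i (g v)
  exhaust v := hL.exhaust (g v)

theorem mkFinCons_repr {K U : Type*} [Field K] [AddCommGroup U] [Module K U] {n : ℕ}
    (v : U) (l : U →ₗ[K] K) (hlv : l v = 1) (b : Module.Basis (Fin n) K (LinearMap.ker l)) :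
    ∃ b' : Module.Basis (Fin (n + 1)) K U, ∀ u, ∃ h : LinearMap.ker l, u = l u • v + h ∧
      b'.repr u 0 = l u ∧ ∀ t : Fin n, b'.repr u t.succ = b.repr h t := by
  have hli : ∀ c : K, ∀ x ∈ LinearMap.ker l, c • v + x = 0 → c = 0 := by
    intro c x hx h
    have := congrArg l h
    rw [map_add, map_smul, hlv, LinearMap.mem_ker.mp hx] at this
    simpa using this
  have hsp : ∀ z : U, ∃ c : K, z + c • v ∈ LinearMap.ker l := by
    intro z
    refine ⟨-l z, ?_⟩
    rw [LinearMap.mem_ker, map_add, map_smul, hlv]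
    simp
  refine ⟨Module.Basis.mkFinCons v b hli hsp, fun u ↦ ?_⟩
  have hu : u - l u • v ∈ LinearMap.ker l := by
    rw [LinearMap.mem_ker, map_sub, map_smul, hlv]
    simp
  have hrepr : (Module.Basis.mkFinCons v b hli hsp).equivFun u
      = Fin.cons (l u) (b.equivFun ⟨_, hu⟩) := by
    rw [← LinearEquiv.eq_symm_apply, Module.Basis.equivFun_symm_apply, Fin.sum_univ_succ]
    simp only [Module.Basis.coe_mkFinCons, Fin.cons_zero, Fin.cons_succ, Function.comp_apply]
    have := congrArg Subtype.val (b.sum_equivFun ⟨_, hu⟩)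
    push_cast at this
    rw [this]
    abel
  refine ⟨⟨_, hu⟩, by simp, ?_, fun t ↦ ?_⟩
  · exact congrFun hrepr 0
  · exact congrFun hrepr t.succ

theorem Splits.cons {e : ℕ} {L : ℤ → Submodule 𝒪[E] V} (hL : IsFiltration e L) {n : ℕ}
    {v : V} {l : V →ₗ[E] E} {b : Module.Basis (Fin n) E (LinearMap.ker l)}
    {b' : Module.Basis (Fin (n + 1)) E V}
    (hb' : ∀ u, ∃ h : LinearMap.ker l, u = l u • v + h ∧
      b'.repr u 0 = l u ∧ ∀ t : Fin n, b'.repr u t.succ = b.repr h t)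
    {j : ℤ} (hv : v ∈ L j) (hl : ∀ m, ∀ u ∈ L m, l u ∈ fracIdeal E e (m - j))
    {α : Fin n → ℤ}
    (hα : Splits e (fun i ↦ (L i).comap ((LinearMap.ker l).subtype.restrictScalars 𝒪[E])) b α) :
    Splits e L b' (Fin.cons j α) := by
  intro m u
  obtain ⟨h, hu, h0, ht⟩ := hb' u
  rw [Fin.forall_fin_succ]
  simp only [Fin.cons_zero, Fin.cons_succ, h0, ht]
  rw [← hα m h]
  change _ ↔ _ ∧ (h : V) ∈ L m
  have hsm : l u ∈ fracIdeal E e (m - j) → l u • v ∈ L m := fun hlu ↦ by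
    have := hL.smul_mem hlu hv
    rwa [add_sub_cancel] at this
  constructor
  · intro hum
    refine ⟨hl m u hum, ?_⟩
    have : (h : V) = u - l u • v := by
      nth_rewrite 1 [hu]
      abel
    rw [this]
    exact sub_mem hum (hsm (hl m u hum))
  · rintro ⟨h1, h2⟩
    rw [hu]
    exact add_mem (hsm h1) h2

/-- Two filtrations of a finite-dimensional space have a common splitting basis. The induction
splits off a vector `v` at which the second filtration is highest in comparison with the first:
a functional splitting off `v` from the first filtration then does so for the second as well. -/
theorem exists_splits (n : ℕ) {e : ℕ} : ∀ {V : Type*} [AddCommGroup V] [Module E V]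
    [FiniteDimensional E V], Module.finrank E V = n → ∀ {L M : ℤ → Submodule 𝒪[E] V},
    IsFiltration e L → IsFiltration e M →
    ∃ (b : Module.Basis (Fin n) E V) (α β : Fin n → ℤ), Splits e L b α ∧ Splits e M b β := by
  induction n with
  | zero =>
    intro V _ _ _ hn L M _ _
    have : Subsingleton V := Module.finrank_zero_iff.mp hn
    refine ⟨Module.finBasisOfFinrankEq E V hn, 0, 0, ?_, ?_⟩ <;>
    · intro j v
      rw [Subsingleton.elim v 0]
      simp [zero_mem]
  | succ n ih =>
    intro V _ _ _ hn L M hL hM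
    have : Nontrivial V := Module.nontrivial_of_finrank_pos (R := E) (by omega)
    obtain ⟨v₀, hv₀⟩ := exists_ne (0 : V)
    have he : (0 : ℤ) < e := by exact_mod_cast hL.pos
    -- the greatest `d` for which some vector lies in `M (j + d)` but not in `L (j + 1)`
    obtain ⟨d, ⟨j, v, hvM, hvL⟩, hmax⟩ := Int.exists_greatest_of_bdd
      (P := fun d ↦ ∃ j v, v ∈ M (j + d) ∧ v ∉ L (j + 1)) (by
        obtain ⟨C, hC⟩ := exists_fg_le hL.antitone hL.exhaust (hM.fg 0)
        refine ⟨e - C, ?_⟩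
        rintro d ⟨j, v, hvM, hvL⟩
        by_contra! hd
        apply hvL
        obtain ⟨k, r, hr0, hre, hm⟩ : ∃ k r : ℤ, 0 ≤ r ∧ r < e ∧ j + d = r + e * k :=
          ⟨(j + d) / e, (j + d) % e, Int.emod_nonneg _ he.ne', Int.emod_lt_of_pos _ he, by
            linarith [Int.emod_add_mul_ediv (j + d) e]⟩
        have h1 : unif E ^ (-k) • v ∈ M 0 := by
          refine hM.antitone hr0 ?_
          have := (hM.zpow_smul_mem (-k) _ v).mpr hvM
          convert this using 2
          rw [hm]
          ring
        have h2 := hC h1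
        rw [← hL.zpow_smul_mem k, smul_smul, ← zpow_add₀ unif_ne_zero, add_neg_cancel, zpow_zero,
          one_smul] at h2
        exact hL.antitone (by linarith) h2) (by
        obtain ⟨j, hj⟩ := hL.exists_notMem hv₀
        obtain ⟨i, hi⟩ := hM.exhaust v₀
        exact ⟨i - (j - 1), j - 1, v₀, by simpa using hi, by simpa using hj⟩)
    have hML : ∀ i, M (i + d) ≤ L i := by
      intro i u hu
      by_contra hu'
      have := hmax (d + 1) ⟨i - 1, u, by convert hu using 2; ring, by simpa using hu'⟩
      linarith
    obtain ⟨l, hlv, hl⟩ := hL.exists_functional (hML j hvM) hvL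
    have hlM : ∀ m, ∀ u ∈ M m, l u ∈ fracIdeal E e (m - (j + d)) := by
      intro m u hu
      have := hl (m - d) u (hML _ (by simpa using hu))
      convert this using 2
      ring
    have hker : Module.finrank E (LinearMap.ker l) = n := by
      have h1 := LinearMap.finrank_range_add_finrank_ker l
      have h2 : LinearMap.range l = ⊤ := by
        rw [LinearMap.range_eq_top]
        intro c
        exact ⟨c • v, by simp [hlv]⟩
      rw [h2, finrank_top, Module.finrank_self, hn] at h1
      omega
    obtain ⟨b, α, β, hα, hβ⟩ := ih hker
      (hL.comap (LinearMap.ker l).subtype Subtype.val_injective)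
      (hM.comap (LinearMap.ker l).subtype Subtype.val_injective)
    obtain ⟨b', hb'⟩ := mkFinCons_repr v l hlv b
    exact ⟨b', Fin.cons j α, Fin.cons (j + d) β, Splits.cons hL hb' (hML j hvM) hl hα,
      Splits.cons hM hb' hvM hlM hβ⟩

/-! ### Adapted bases of a uniform lattice chain -/

section Translate

variable {R K M : Type*} [CommRing R] [Field K] [Algebra R K] [AddCommGroup M] [Module R M]
  [Module K M] [IsScalarTower R K M]

/-- The translate `x L` of a filtration by a linear automorphism `x`: it consists of the
`x (L i)`. -/
def translate (L : ℤ → Submodule R M) (x : LinearMap.GeneralLinearGroup K M) (i : ℤ) :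
    Submodule R M :=
  (L i).comap (((x⁻¹ : LinearMap.GeneralLinearGroup K M) : Module.End K M).restrictScalars R)

theorem mem_translate {L : ℤ → Submodule R M} {x : LinearMap.GeneralLinearGroup K M} {i : ℤ}
    {v : M} : v ∈ translate L x i ↔
      ((x⁻¹ : LinearMap.GeneralLinearGroup K M) : Module.End K M) v ∈ L i := Iff.rfl

theorem units_inv_apply_self (x : LinearMap.GeneralLinearGroup K M) (v : M) :
    ((x⁻¹ : LinearMap.GeneralLinearGroup K M) : Module.End K M) ((x : Module.End K M) v) = v :=
  LinearMap.congr_fun (Units.inv_mul x) v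

theorem units_apply_inv_self (x : LinearMap.GeneralLinearGroup K M) (v : M) :
    (x : Module.End K M) (((x⁻¹ : LinearMap.GeneralLinearGroup K M) : Module.End K M) v) = v :=
  LinearMap.congr_fun (Units.mul_inv x) v

end Translate

theorem maximalIdeal_eq_span_unif :
    𝓂[E] = Ideal.span {(⟨unif E, unif_mem_integer⟩ : 𝒪[E])} := by
  ext a
  rw [Ideal.mem_span_singleton]
  by_cases ha : (a : E) = 0
  · have : a = 0 := Subtype.ext ha
    simp [this]
  rw [mem_maximalIdeal_iff_ord ha]
  have h0 : (unif E)⁻¹ * (a : E) ≠ 0 := mul_ne_zero (inv_ne_zero unif_ne_zero) ha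
  have h1 : ord ((unif E)⁻¹ * (a : E)) = ord (a : E) - 1 := by
    rw [ord_mul (inv_ne_zero unif_ne_zero) ha, ← zpow_neg_one, ord_unif_zpow]
    ring
  constructor
  · intro h
    refine ⟨⟨(unif E)⁻¹ * a, (mem_integer_iff_ord h0).mpr (by omega)⟩, Subtype.ext ?_⟩
    change (a : E) = unif E * ((unif E)⁻¹ * a)
    rw [mul_inv_cancel_left₀ unif_ne_zero]
  · rintro ⟨c, rfl⟩
    change (unif E * (c : E)) ≠ 0 at ha
    change 0 < ord (unif E * (c : E))
    have hc : (c : E) ≠ 0 := right_ne_zero_of_mul ha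
    have := (mem_integer_iff_ord hc).mp c.2
    rw [ord_mul unif_ne_zero hc, ord_unif]
    omega

theorem LatticeChain.unif_smul_mem (Λ : LatticeChain E V) (i : ℤ) (v : V) :
    unif E • v ∈ Λ.L (i + Λ.period) ↔ v ∈ Λ.L i := by
  rw [Λ.periodic, maximalIdeal_eq_span_unif, Submodule.ideal_span_singleton_smul]
  constructor
  · intro h
    obtain ⟨u, hu, huv⟩ := (Submodule.mem_smul_pointwise_iff_exists _ _ _).mp h
    change unif E • u = unif E • v at huv
    rwa [← smul_right_injective V unif_ne_zero huv]
  · intro h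
    exact Submodule.smul_mem_pointwise_smul v (⟨unif E, unif_mem_integer⟩ : 𝒪[E]) _ h

theorem LatticeChain.isFiltration (Λ : LatticeChain E V) : IsFiltration Λ.period Λ.L where
  pos := Λ.period_pos
  antitone := Λ.strictAnti.antitone
  fg i := (Λ.isLattice i).fg
  unif_smul_mem := Λ.unif_smul_mem
  exhaust v := by
    have hv : v ∈ Submodule.span E (Λ.L 0 : Set V) := by
      rw [(Λ.isLattice 0).span_eq_top]
      trivial
    induction hv using Submodule.span_induction with
    | mem v hv => exact ⟨0, hv⟩
    | zero => exact ⟨0, zero_mem _⟩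
    | add v w _ _ hv hw =>
      obtain ⟨i, hi⟩ := hv
      obtain ⟨j, hj⟩ := hw
      exact ⟨min i j, add_mem (Λ.strictAnti.antitone (min_le_left _ _) hi)
        (Λ.strictAnti.antitone (min_le_right _ _) hj)⟩
    | smul c v _ hv =>
      obtain ⟨i, hi⟩ := hv
      by_cases hc : c = 0
      · exact ⟨0, by rw [hc, zero_smul]; exact zero_mem _⟩
      obtain ⟨u, hu, -⟩ := eq_unif_zpow_mul hc
      refine ⟨i + Λ.period * ord c, ?_⟩
      rw [hu, mul_smul, ← hu]
      exact (zpow_smul_mem_iff Λ.unif_smul_mem _ _ _).mpr ((Λ.L i).smul_mem u hi)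

theorem IsFiltration.translate {e : ℕ} {L : ℤ → Submodule 𝒪[E] V} (hL : IsFiltration e L)
    (x : LinearMap.GeneralLinearGroup E V) : IsFiltration e (translate L x) :=
  hL.comap _ (Function.LeftInverse.injective (units_apply_inv_self x))

theorem Splits.unitsSMul {e : ℕ} {L : ℤ → Submodule 𝒪[E] V} {ι : Type*}
    {b : Module.Basis ι E V} {α : ι → ℤ} (h : Splits e L b α) (k : ι → ℤ) :
    Splits e L (b.unitsSMul fun t ↦ Units.mk0 (unif E ^ k t) (zpow_ne_zero _ unif_ne_zero))
      fun t ↦ α t + e * k t := by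
  intro j v
  rw [h j v]
  refine forall_congr' fun t ↦ ?_
  rw [Module.Basis.repr_unitsSMul, Units.smul_def, Units.val_inv_eq_inv_val, Units.val_mk0,
    ← zpow_neg,
    smul_eq_mul, unif_zpow_mul_mem_fracIdeal_iff]
  ring_nf

theorem Splits.reindex {e : ℕ} {L : ℤ → Submodule 𝒪[E] V} {ι κ : Type*}
    {b : Module.Basis ι E V} {α : ι → ℤ} (h : Splits e L b α) (σ : ι ≃ κ) :
    Splits e L (b.reindex σ) (α ∘ σ.symm) := by
  intro j v
  rw [h j v, σ.symm.forall_congr_left]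
  simp

theorem fracIdeal_add_one {e : ℕ} {k : ℤ} (hk : ¬ (e : ℤ) ∣ k) :
    fracIdeal E e (k + 1) = fracIdeal E e k := by
  refine le_antisymm (fracIdeal_antitone e (by simp)) ?_
  rintro c (hc | hc)
  · exact Or.inl hc
  · exact Or.inr (lt_of_le_of_ne hc fun h ↦ hk ⟨_, h⟩)

/-- The residue of a scalar, with the junk value `0` on scalars that are not integral. -/
def res (c : E) : 𝓀[E] := open Classical in
  if h : c ∈ 𝒪[E] then IsLocalRing.residue 𝒪[E] ⟨c, h⟩ else 0

theorem res_coe (c : 𝒪[E]) : res (c : E) = IsLocalRing.residue 𝒪[E] c := by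
  rw [res, dif_pos c.2]

theorem res_zero : res (0 : E) = 0 := by
  rw [← ZeroMemClass.coe_zero 𝒪[E], res_coe, map_zero]

theorem res_one : res (1 : E) = 1 := by
  rw [← OneMemClass.coe_one 𝒪[E], res_coe, map_one]

theorem res_add {c d : E} (hc : c ∈ 𝒪[E]) (hd : d ∈ 𝒪[E]) : res (c + d) = res c + res d := by
  lift c to 𝒪[E] using hc
  lift d to 𝒪[E] using hd
  rw [← Subring.coe_add, res_coe, res_coe, res_coe, map_add]

theorem res_smul (a : 𝒪[E]) {c : E} (hc : c ∈ 𝒪[E]) : res (a • c) = a • res c := by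
  lift c to 𝒪[E] using hc
  rw [Subring.smul_def, smul_eq_mul, ← Subring.coe_mul, res_coe, res_coe, map_mul]
  rfl

section GrEquiv

variable {e : ℕ} {L : ℤ → Submodule 𝒪[E] V} {ι : Type*} {b : Module.Basis ι E V} {α : ι → ℤ}
  {S : Type*} {j : ℤ} {σ : S → ι}

theorem Splits.repr_mem_integer (h : Splits e L b α) (he : 0 < e) {t : ι}
    (ht : α t = j) {v : V} (hv : v ∈ L j) : b.repr v t ∈ 𝒪[E] := by
  rw [← mem_fracIdeal_zero_iff he]
  simpa [ht] using (h j v).mp hv t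

/-- The coordinates, modulo `𝔭_E`, of a vector in `L j` with respect to the basis vectors of
degree `j`. -/
def grMap (h : Splits e L b α) (he : 0 < e) (hσ : ∀ s, α (σ s) = j) :
    L j →ₗ[𝒪[E]] (S → 𝓀[E]) where
  toFun v s := res (b.repr v (σ s))
  map_add' v w := by
    ext s
    simp only [Submodule.coe_add, map_add, Finsupp.add_apply, Pi.add_apply]
    exact res_add (h.repr_mem_integer he (hσ s) v.2) (h.repr_mem_integer he (hσ s) w.2)
  map_smul' a v := by
    ext s
    have h1 : b.repr ((a • v : L j) : V) = (a : E) • b.repr (v : V) := by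
      rw [← map_smul]
      rfl
    simp only [h1, Finsupp.smul_apply, Pi.smul_apply, RingHom.id_apply]
    exact res_smul a (h.repr_mem_integer he (hσ s) v.2)

theorem grMap_ker (h : Splits e L b α) (he : 0 < e) (hσ : ∀ s, α (σ s) = j)
    (hσ' : ∀ t, (e : ℤ) ∣ j - α t → ∃ s, σ s = t) :
    LinearMap.ker (grMap h he hσ) = (L (j + 1)).submoduleOf (L j) := by
  ext v
  change grMap h he hσ v = 0 ↔ (v : V) ∈ L (j + 1)
  rw [h (j + 1), funext_iff]
  have hfrac : ∀ c : E, c ∈ 𝒪[E] → (res c = 0 ↔ c ∈ fracIdeal E e 1) := by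
    intro c hc
    lift c to 𝒪[E] using hc
    rw [mem_fracIdeal_iff_mem_maximalIdeal zero_lt_one (by exact_mod_cast he), res_coe,
      IsLocalRing.residue_eq_zero_iff]
  constructor
  · intro hv t
    by_cases ht : (e : ℤ) ∣ j - α t
    · obtain ⟨s, rfl⟩ := hσ' t ht
      have := (hfrac _ (h.repr_mem_integer he (hσ s) v.2)).mp (hv s)
      rw [hσ s]
      simpa using this
    · have := (h j v).mp v.2 t
      rw [← fracIdeal_add_one ht] at this
      convert this using 2
      ring
  · intro hv s
    refine (hfrac _ (h.repr_mem_integer he (hσ s) v.2)).mpr ?_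
    have := hv (σ s)
    rw [hσ s] at this
    simpa using this

theorem grMap_surjective [Finite S] (h : Splits e L b α) (he : 0 < e) (hσ : ∀ s, α (σ s) = j)
    (hinj : Function.Injective σ) : Function.Surjective (grMap h he hσ) := by
  classical
  have := Fintype.ofFinite S
  intro y
  choose z hz using fun s ↦ IsLocalRing.residue_surjective (y s)
  have hrepr : ∀ t, b.repr (∑ s, (z s : E) • b (σ s)) t
      = ∑ s, if σ s = t then (z s : E) else 0 := by
    intro t
    simp [Finsupp.single_apply]
  refine ⟨⟨∑ s, (z s : E) • b (σ s), (h j _).mpr fun t ↦ ?_⟩, ?_⟩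
  · rw [hrepr]
    refine sum_mem fun s _ ↦ ?_
    split_ifs with hs
    · rw [← hs, hσ s, sub_self, mem_fracIdeal_zero_iff he]
      exact (z s).2
    · exact zero_mem _
  · ext s
    change res (b.repr _ (σ s)) = _
    rw [hrepr]
    simp only [hinj.eq_iff]
    rw [Finset.sum_ite_eq' Finset.univ s, if_pos (Finset.mem_univ s), res_coe, hz]

/-- The basis vectors of degree `j` of a splitting basis give a basis of `L j / L (j + 1)`. -/
def grEquiv [Finite S] (h : Splits e L b α) (he : 0 < e) (hσ : ∀ s, α (σ s) = j)
    (hinj : Function.Injective σ) (hσ' : ∀ t, (e : ℤ) ∣ j - α t → ∃ s, σ s = t) :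
    (L j ⧸ (L (j + 1)).submoduleOf (L j)) ≃ₗ[𝒪[E]] (S → 𝓀[E]) :=
  (Submodule.quotEquivOfEq _ _ (grMap_ker h he hσ hσ').symm).trans
    ((grMap h he hσ).quotKerEquivOfSurjective (grMap_surjective h he hσ hinj))

end GrEquiv

theorem eq_of_dvd_sub {e : ℕ} {a b : ℤ} (ha : 0 ≤ a) (ha' : a < e) (hb : 0 ≤ b) (hb' : b < e)
    (h : (e : ℤ) ∣ a - b) : a = b := by
  have := Int.eq_zero_of_abs_lt_dvd h (by rw [abs_lt]; constructor <;> linarith)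
  linarith

/-- A uniform lattice chain and a translate of it have a common splitting basis, which can be
indexed by the degree `j ∈ {0, …, e - 1}` with respect to the chain itself and a number in
`{0, …, f - 1}`. -/
theorem exists_adapted_basis [FiniteDimensional E V] (Λ : LatticeChain E V) {f : ℕ}
    (φ : Λ.Framing f) (x : LinearMap.GeneralLinearGroup E V) :
    ∃ (b : Module.Basis (Fin Λ.period × Fin f) E V) (β : Fin Λ.period × Fin f → ℤ),
      Splits Λ.period Λ.L b (fun t ↦ ((t.1 : ℕ) : ℤ)) ∧
        Splits Λ.period (translate Λ.L x) b β := by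
  classical
  obtain ⟨b, α, β, hα, hβ⟩ := exists_splits (E := E) _ (V := V) rfl Λ.isFiltration
    (Λ.isFiltration.translate x)
  have he : (0 : ℤ) < Λ.period := by exact_mod_cast Λ.period_pos
  -- rescale the basis vectors so that their degrees lie in `[0, e)`
  have hα' := hα.unitsSMul fun t ↦ -(α t / Λ.period)
  have hβ' := hβ.unitsSMul fun t ↦ -(α t / Λ.period)
  have hmod : (fun t ↦ α t + Λ.period * -(α t / Λ.period))
      = fun t ↦ α t % Λ.period := by
    funext t
    rw [Int.emod_def]
    ring
  rw [hmod] at hα'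
  set b' := b.unitsSMul fun t ↦
    Units.mk0 (unif E ^ (-(α t / Λ.period))) (zpow_ne_zero _ unif_ne_zero)
  have hcard : ∀ j : Fin Λ.period, Nonempty ({t // α t % Λ.period = ((j : ℕ) : ℤ)} ≃ Fin f) := by
    intro j
    have e1 := grEquiv (σ := fun t : {t // α t % Λ.period = ((j : ℕ) : ℤ)} ↦ t.1)
      hα' Λ.period_pos (fun s ↦ s.2) Subtype.val_injective (by
        intro t ht
        have := eq_of_dvd_sub (by positivity) (by exact_mod_cast j.2)
          (Int.emod_nonneg _ he.ne') (Int.emod_lt_of_pos _ he) ht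
        exact ⟨⟨t, this.symm⟩, rfl⟩)
    have e2 := (e1.symm.trans (φ j)).toEquiv
    have h1 := Nat.card_congr e2
    rw [Nat.card_fun, Nat.card_fun] at h1
    have h2 := Nat.pow_right_injective (Finite.one_lt_card (α := 𝓀[E])) h1
    exact Finite.card_eq.mp h2
  have σ' := fun j ↦ (hcard j).some
  let τ : Fin (Module.finrank E V) → Fin Λ.period := fun t ↦
    ⟨(α t % Λ.period).toNat, by
      have := Int.emod_lt_of_pos (α t) he
      have := Int.emod_nonneg (α t) he.ne'
      omega⟩
  have hτ : ∀ t j, τ t = j ↔ α t % Λ.period = ((j : ℕ) : ℤ) := by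
    intro t j
    have := Int.emod_nonneg (α t) he.ne'
    rw [Fin.ext_iff]
    simp only [τ]
    omega
  let σ : Fin (Module.finrank E V) ≃ Fin Λ.period × Fin f :=
    (Equiv.sigmaFiberEquiv τ).symm.trans
      ((Equiv.sigmaCongrRight fun j ↦
        (Equiv.subtypeEquivRight fun t ↦ hτ t j).trans (σ' j)).trans
          (Equiv.sigmaEquivProd _ _))
  have hσ : ∀ t, (σ t).1 = τ t := fun t ↦ rfl
  refine ⟨b'.reindex σ, _, ?_, hβ'.reindex σ⟩
  convert hα'.reindex σ using 1
  funext t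
  refine ((hτ (σ.symm t) t.1).mp ?_).symm
  rw [← hσ, Equiv.apply_symm_apply]

/-! ### Periodic permutations of the integers -/

/-- A function of the integers commuting with the translation by `e` commutes with the
translations by multiples of `e`. -/
theorem map_add_mul {e : ℕ} {e' : ℤ} {π : ℤ → ℤ} (hπ : ∀ m, π (m + e) = π m + e') (m k : ℤ) :
    π (m + e * k) = π m + e' * k := by
  induction k using Int.induction_on with
  | zero => simp
  | succ k ih =>
    have := hπ (m + e * k)
    rw [ih] at this
    convert this using 1 <;> ring_nf
  | pred k ih =>
    have := hπ (m + e * (-k - 1))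
    rw [show m + (e : ℤ) * (-k - 1) + e = m + e * (-k) by ring, ih] at this
    linarith

theorem symm_map_add {e : ℕ} {π : ℤ ≃ ℤ} (hπ : ∀ m, π (m + e) = π m + e) (m : ℤ) :
    π.symm (m + e) = π.symm m + e := by
  rw [Equiv.symm_apply_eq, hπ, Equiv.apply_symm_apply]

section Periodic

variable {e : ℕ} [NeZero e]

/-- The residue of an integer modulo `e`, as an element of `{0, …, e - 1}`. -/
def idx (e : ℕ) [NeZero e] (m : ℤ) : Fin e := (Int.divModEquiv e m).2

theorem idx_add_mul_ediv (m : ℤ) : ((idx e m : ℕ) : ℤ) + e * (m / e) = m := by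
  have := (Int.divModEquiv e).symm_apply_apply m
  rw [Int.divModEquiv_symm_apply] at this
  rw [mul_comm, add_comm]
  exact this

theorem divModEquiv_add_mul (j : Fin e) (k : ℤ) :
    Int.divModEquiv e (((j : ℕ) : ℤ) + e * k) = (k, j) := by
  rw [← Equiv.eq_symm_apply, Int.divModEquiv_symm_apply]
  ring

theorem idx_coe_add_mul (j : Fin e) (k : ℤ) : idx e (((j : ℕ) : ℤ) + e * k) = j := by
  rw [idx, divModEquiv_add_mul]

theorem ediv_coe_add_mul (j : Fin e) (k : ℤ) : (((j : ℕ) : ℤ) + e * k) / (e : ℤ) = k :=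
  congrArg Prod.fst (divModEquiv_add_mul j k)

theorem idx_coe (j : Fin e) : idx e ((j : ℕ) : ℤ) = j := by
  simpa using idx_coe_add_mul j 0

theorem ediv_coe (j : Fin e) : ((j : ℕ) : ℤ) / (e : ℤ) = 0 := by
  simpa using ediv_coe_add_mul j 0

theorem idx_add_mul (m k : ℤ) : idx e (m + e * k) = idx e m := by
  conv_lhs => rw [← idx_add_mul_ediv (e := e) m, add_assoc, ← mul_add, idx_coe_add_mul]

theorem add_mul_ediv (m k : ℤ) : (m + e * k) / (e : ℤ) = m / e + k :=
  Int.add_mul_ediv_left _ _ (by exact_mod_cast NeZero.ne e)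

/-- A function on `{0, …, e - 1}` that meets every class modulo `e` extends to a periodic
permutation of the integers. -/
theorem exists_periodic_extension (β : Fin e → ℤ) (hβ : ∀ r : ℤ, ∃ j, (e : ℤ) ∣ r - β j) :
    ∃ π : ℤ ≃ ℤ, (∀ m, π (m + e) = π m + e) ∧ ∀ j : Fin e, π ((j : ℕ) : ℤ) = β j := by
  have hsurj : Function.Surjective fun j ↦ idx e (β j) := by
    intro r
    obtain ⟨j, k, hk⟩ := hβ ((r : ℕ) : ℤ)
    refine ⟨j, ?_⟩
    have : β j = ((r : ℕ) : ℤ) + e * (-k) := by linarith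
    simp only [this, idx_coe_add_mul]
  have hinj := Finite.injective_iff_surjective.mpr hsurj
  have hbij : Function.Bijective fun m : ℤ ↦ β (idx e m) + e * (m / e) := by
    constructor
    · intro m n hmn
      simp only at hmn
      have h1 : idx e m = idx e n := by
        apply hinj
        have := congrArg (idx e) hmn
        rwa [idx_add_mul, idx_add_mul] at this
      rw [h1] at hmn
      rw [← idx_add_mul_ediv (e := e) m, ← idx_add_mul_ediv (e := e) n, h1]
      linarith
    · intro r
      obtain ⟨j, k, hk⟩ := hβ r
      refine ⟨((j : ℕ) : ℤ) + e * k, ?_⟩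
      simp only [idx_coe_add_mul, ediv_coe_add_mul]
      linarith
  refine ⟨Equiv.ofBijective _ hbij, fun m ↦ ?_, fun j ↦ ?_⟩
  · have h1 := idx_add_mul (e := e) m 1
    have h2 := add_mul_ediv (e := e) m 1
    rw [mul_one] at h1 h2
    simp only [Equiv.ofBijective_apply, h1, h2]
    ring
  · simp only [Equiv.ofBijective_apply, idx_coe, ediv_coe]
    ring

/-- The periodic permutation of the integers that acts on `s + {0, …, e - 1}` by `σ`. -/
def extendPerm (s : ℤ) (σ : Equiv.Perm (Fin e)) : ℤ ≃ ℤ :=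
  (Equiv.subRight s).trans (((Int.divModEquiv e).trans
    ((Equiv.prodCongr (Equiv.refl ℤ) σ).trans (Int.divModEquiv e).symm)).trans (Equiv.addRight s))

theorem extendPerm_apply (s : ℤ) (σ : Equiv.Perm (Fin e)) (j : Fin e) (k : ℤ) :
    extendPerm s σ (s + ((j : ℕ) : ℤ) + e * k) = s + ((σ j : ℕ) : ℤ) + e * k := by
  have h1 : s + ((j : ℕ) : ℤ) + e * k - s = ((j : ℕ) : ℤ) + e * k := by ring
  simp only [extendPerm, Equiv.trans_apply, Equiv.subRight_apply, h1, divModEquiv_add_mul,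
    Equiv.prodCongr_apply, Prod.map_apply, Equiv.refl_apply, Int.divModEquiv_symm_apply,
    Equiv.coe_addRight]
  ring

theorem exists_eq_add_add_mul (s m : ℤ) :
    ∃ (j : Fin e) (k : ℤ), m = s + ((j : ℕ) : ℤ) + e * k :=
  ⟨idx e (m - s), (m - s) / e, by linarith [idx_add_mul_ediv (e := e) (m - s)]⟩

/-- Let `B : ℤ → ℤ` be a monotone periodic function, so that its fibres, the blocks, are
intervals. Every periodic permutation `π` can be changed, without changing the blocks of its
values, into a periodic permutation `q` that is increasing as long as its values stay in one
block. -/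
theorem exists_sorted_permutation {π : ℤ ≃ ℤ} (hπ : ∀ m, π (m + e) = π m + e) {B s : ℤ → ℤ}
    {e' : ℤ} (hgc : ∀ i m, s i ≤ m ↔ i ≤ B m) (hB : ∀ m, B (m + e) = B m + e') :
    ∃ q : ℤ ≃ ℤ, (∀ m, q (m + e) = q m + e) ∧ (∀ m, B (q m) = B (π m)) ∧
      ∀ m m', B (q m) = B (q m') → m < m' → q m < q m' := by
  have hmono : Monotone B := fun m n h ↦ (hgc _ _).mp (((hgc _ _).mpr le_rfl).trans h)
  -- sort one period, which starts with the block `0`, by the block and the preimage under `π`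
  let g : Fin e → ℤ := fun j ↦ B (s 0 + ((j : ℕ) : ℤ))
  let F : Fin e → ℤ ×ₗ ℤ := fun j ↦ toLex (g j, π.symm (s 0 + ((j : ℕ) : ℤ)))
  let σ := Tuple.sort F
  have hF : Monotone (F ∘ σ) := Tuple.monotone_sort F
  have hg : g ∘ σ = g := by
    refine Tuple.unique_monotone (f := g) (σ := σ) (τ := 1) (fun j j' h ↦ ?_) (fun j j' h ↦ ?_)
    · exact ((Prod.Lex.toLex_le_toLex).mp (hF h)).elim (fun h ↦ h.le) (fun h ↦ h.1.le)
    · refine hmono ?_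
      have : (j : ℕ) ≤ j' := h
      simpa using this
  have hBσ : ∀ m, B (extendPerm (s 0) σ m) = B m := by
    intro m
    obtain ⟨j, k, rfl⟩ := exists_eq_add_add_mul (e := e) (s 0) m
    rw [extendPerm_apply, map_add_mul hB, map_add_mul hB]
    exact congrArg (· + e' * k) (congrFun hg j)
  have hper : ∀ m, extendPerm (s 0) σ (m + e) = extendPerm (s 0) σ m + e := by
    intro m
    obtain ⟨j, k, rfl⟩ := exists_eq_add_add_mul (e := e) (s 0) m
    have : s 0 + ((j : ℕ) : ℤ) + e * k + e = s 0 + ((j : ℕ) : ℤ) + e * (k + 1) := by ring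
    rw [this, extendPerm_apply, extendPerm_apply]
    ring
  -- the inverse `p` of the permutation to be constructed is increasing on blocks
  have hp : ∀ m m', B m = B m' → m < m' →
      π.symm (extendPerm (s 0) σ m) < π.symm (extendPerm (s 0) σ m') := by
    intro m m' hBm hlt
    obtain ⟨j, k, hm⟩ := exists_eq_add_add_mul (e := e) (s 0) m
    obtain ⟨j', k', hm'⟩ := exists_eq_add_add_mul (e := e) (s 0) m'
    have hj : ((j : ℕ) : ℤ) < e := by exact_mod_cast j.2
    have hj' : ((j' : ℕ) : ℤ) < e := by exact_mod_cast j'.2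
    have hj0 : (0 : ℤ) ≤ ((j : ℕ) : ℤ) := by positivity
    have hj0' : (0 : ℤ) ≤ ((j' : ℕ) : ℤ) := by positivity
    have hkk : k' ≤ k := by
      have h1 : s 0 ≤ m' + e * (-k') := by
        rw [hm']
        linarith
      rw [hgc, map_add_mul hB, ← hBm, ← map_add_mul hB, ← hgc, hm] at h1
      by_contra! h
      have : (e : ℤ) * (k + 1) ≤ e * k' := by gcongr; omega
      linarith
    have hkk' : k ≤ k' := by
      by_contra! h
      have : (e : ℤ) * (k' + 1) ≤ e * k := by gcongr; omega
      linarith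
    obtain rfl := le_antisymm hkk hkk'
    have hjj : j < j' := by
      rw [Fin.lt_def]
      have : ((j : ℕ) : ℤ) < ((j' : ℕ) : ℤ) := by linarith
      exact_mod_cast this
    have hne : F (σ j) ≠ F (σ j') := by
      intro h
      have h2 := congrArg (fun z ↦ (ofLex z).2) h
      simp only [F, ofLex_toLex, EmbeddingLike.apply_eq_iff_eq, add_right_inj, Nat.cast_inj] at h2
      exact hjj.ne (σ.injective (Fin.ext h2))
    have hltF := lt_of_le_of_ne (hF hjj.le) hne
    have hgg : g (σ j) = g (σ j') := by
      have h1 := congrFun hg j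
      have h2 := congrFun hg j'
      simp only [Function.comp_apply] at h1 h2
      rw [h1, h2]
      rw [hm, hm', map_add_mul hB, map_add_mul hB] at hBm
      exact add_right_cancel hBm
    have h3 := (Prod.Lex.toLex_lt_toLex.mp hltF).resolve_left (by simp [hgg])
    rw [hm, hm', extendPerm_apply, extendPerm_apply, map_add_mul (symm_map_add hπ),
      map_add_mul (symm_map_add hπ)]
    simpa using h3.2
  refine ⟨π.trans (extendPerm (s 0) σ).symm, fun m ↦ ?_, fun m ↦ ?_, fun m m' hm hlt ↦ ?_⟩
  · rw [Equiv.trans_apply, hπ, symm_map_add hper, Equiv.trans_apply]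
  · rw [Equiv.trans_apply, ← hBσ, Equiv.apply_symm_apply]
  · by_contra! h
    rcases h.lt_or_eq with h | h
    · have := hp _ _ hm.symm h
      simp only [Equiv.trans_apply, Equiv.apply_symm_apply, Equiv.symm_apply_apply] at this
      exact absurd this (not_lt.mpr hlt.le)
    · exact hlt.ne' (Equiv.injective _ h)

/-- The counting function of the values of a strictly increasing function of the integers. -/
theorem exists_block_function {s : ℤ → ℤ} (hs : StrictMono s) :
    ∃ B : ℤ → ℤ, ∀ i m, s i ≤ m ↔ i ≤ B m := by
  have h1 : ∀ (i : ℤ) (n : ℕ), s i + n ≤ s (i + n) := by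
    intro i n
    induction n with
    | zero => simp
    | succ n ih =>
      have : s (i + n) < s (i + n + 1) := hs (by simp)
      push_cast
      rw [← add_assoc, ← add_assoc]
      omega
  have h2 : ∀ m : ℤ, ∃ b, s b ≤ m ∧ ∀ z, s z ≤ m → z ≤ b := by
    intro m
    refine Int.exists_greatest_of_bdd ⟨max 0 (m - s 0), fun z hz ↦ ?_⟩
      ⟨-((s 0 - m).toNat : ℤ), ?_⟩
    · rcases le_total z 0 with h | h
      · exact h.trans (le_max_left _ _)
      · have := h1 0 z.toNat
        rw [Int.toNat_of_nonneg h, zero_add] at this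
        exact le_max_of_le_right (by linarith)
    · have := h1 (-((s 0 - m).toNat : ℤ)) (s 0 - m).toNat
      rw [neg_add_cancel] at this
      omega
  choose B hB hB' using h2
  exact ⟨B, fun i m ↦ ⟨hB' m i, fun h ↦ (hs.monotone h).trans (hB m)⟩⟩

end Periodic

/-! ### Units and radical of a hereditary order -/

theorem mem_conj_iff {G : Type*} [Group G] {H : Subgroup G} {x g : G} :
    g ∈ conj H x ↔ x⁻¹ * g * x ∈ H :=
  ⟨inv_mul_mul_mem_of_mem_conj, fun h ↦ ⟨_, h, by simp [mul_assoc]⟩⟩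

namespace LatticeChain

variable (Λ : LatticeChain E V)

instance : NeZero Λ.period := ⟨Λ.period_pos.ne'⟩

/-- The endomorphisms mapping each lattice of the chain to the next one; they form the radical of
the order of the chain. -/
def IsRadical (r : Module.End E V) : Prop := ∀ i, ∀ v ∈ Λ.L i, r v ∈ Λ.L (i + 1)

variable {Λ}

theorem IsRadical.mem_order {r : Module.End E V} (hr : Λ.IsRadical r) : r ∈ Λ.order :=
  fun i v hv ↦ Λ.strictAnti.antitone (by simp) (hr i v hv)

theorem IsRadical.mul_left {r y : Module.End E V} (hr : Λ.IsRadical r) (hy : y ∈ Λ.order) :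
    Λ.IsRadical (y * r) :=
  fun i v hv ↦ hy (i + 1) _ (hr i v hv)

/-- By Nakayama's lemma, `1 + r` maps each `L i` onto itself if `r` lies in the radical. -/
theorem IsRadical.exists_eq_one_add [FiniteDimensional E V] {r : Module.End E V}
    (hr : Λ.IsRadical r) : ∃ u ∈ U Λ.order, (u : Module.End E V) = 1 + r := by
  have hmap : ∀ i, Λ.L i ≤ (Λ.L i).map ((1 + r).restrictScalars 𝒪[E]) := by
    intro i
    have h1 : ∀ n : ℕ, Λ.L i ≤ (Λ.L i).map ((1 + r).restrictScalars 𝒪[E]) ⊔ Λ.L (i + n) := by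
      intro n
      induction n with
      | zero => simp
      | succ n ih =>
        refine ih.trans (sup_le le_sup_left fun v hv ↦ ?_)
        have h2 : v = (1 + r) v - r v := by simp
        rw [h2]
        refine sub_mem (Submodule.mem_sup_left (Submodule.mem_map_of_mem ?_))
          (Submodule.mem_sup_right ?_)
        · exact Λ.strictAnti.antitone (by simp) hv
        · have := hr _ v hv
          push_cast
          rwa [← add_assoc]
    refine Submodule.le_of_le_smul_of_le_jacobson_bot (Λ.isLattice i).fg
      (IsLocalRing.maximalIdeal_le_jacobson ⊥) ?_
    rw [← Λ.periodic]
    exact h1 Λ.period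
  have hsurj : Function.Surjective (1 + r : Module.End E V) := by
    intro v
    obtain ⟨i, hi⟩ := Λ.isFiltration.exhaust v
    obtain ⟨u, -, hu⟩ := hmap i hi
    exact ⟨u, hu⟩
  have hunit : IsUnit (1 + r) := (Module.End.isUnit_iff _).mpr
    ⟨LinearMap.injective_iff_surjective.mpr hsurj, hsurj⟩
  obtain ⟨u, hu⟩ := hunit
  refine ⟨u, (Submonoid.mem_units_iff _ _).mpr ⟨?_, ?_⟩, hu⟩
  · rw [hu]
    exact Λ.order.add_mem Λ.order.one_mem hr.mem_order
  · intro i v hv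
    obtain ⟨v', hv', hv''⟩ := hmap i hv
    rw [← hv'', LinearMap.coe_restrictScalars, ← hu, units_inv_apply_self]
    exact hv'

theorem IsRadical.mem_jacobson [FiniteDimensional E V] {r : Module.End E V}
    (hr : Λ.IsRadical r) : (⟨r, hr.mem_order⟩ : Λ.order) ∈ Ring.jacobson Λ.order := by
  rw [← Ideal.jacobson_bot, Ideal.mem_jacobson_iff]
  intro y
  obtain ⟨u, hu, hu'⟩ := (hr.mul_left y.2).exists_eq_one_add
  refine ⟨⟨_, ((Submonoid.mem_units_iff _ _).mp hu).2⟩, ?_⟩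
  rw [Ideal.mem_bot]
  apply Subtype.ext
  have h := Units.inv_mul u
  rw [hu', mul_add, mul_one] at h
  change ((u⁻¹ : (Module.End E V)ˣ) : Module.End E V) * y * r
    + ((u⁻¹ : (Module.End E V)ˣ) : Module.End E V) - 1 = 0
  rw [mul_assoc, add_comm, h, sub_self]

theorem mem_U_iff {u : (Module.End E V)ˣ} : u ∈ U Λ.order ↔
    (u : Module.End E V) ∈ Λ.order ∧ ((u⁻¹ : (Module.End E V)ˣ) : Module.End E V) ∈ Λ.order :=
  Submonoid.mem_units_iff _ _

theorem mem_U1_of_isRadical [FiniteDimensional E V] {u : U Λ.order}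
    (hu : Λ.IsRadical ((u : (Module.End E V)ˣ) - 1 : Module.End E V)) : u ∈ U1 Λ.order :=
  (mem_U1_iff _ _).mpr hu.mem_jacobson

/-- If an automorphism `a` maps `N` into itself and its inverse maps the lattice `M` into itself,
then the inverse maps `N ⊓ M` into `N`: the increasing sequence of the modules `a⁻ⁿ N ⊓ M` becomes
stationary. -/
theorem inv_apply_mem {N M : Submodule 𝒪[E] V} (hM : M.FG) {a : LinearMap.GeneralLinearGroup E V}
    (hN : ∀ v ∈ N, (a : Module.End E V) v ∈ N)
    (haM : ∀ v ∈ M, ((a⁻¹ : LinearMap.GeneralLinearGroup E V) : Module.End E V) v ∈ M)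
    {v : V} (hvN : v ∈ N) (hvM : v ∈ M) :
    ((a⁻¹ : LinearMap.GeneralLinearGroup E V) : Module.End E V) v ∈ N := by
  have : Module.Finite 𝒪[E] M := Module.Finite.iff_fg.mpr hM
  let F : ℕ →o Submodule 𝒪[E] M :=
    { toFun n := N.comap ((((a : Module.End E V) ^ n).restrictScalars 𝒪[E]) ∘ₗ M.subtype)
      monotone' := by
        refine monotone_nat_of_le_succ fun n u hu ↦ ?_
        change ((a : Module.End E V) ^ (n + 1)) (u : V) ∈ N
        rw [pow_succ']
        exact hN _ hu }
  obtain ⟨n, hn⟩ := monotone_stabilizes_iff_noetherian.mpr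
    (inferInstance : IsNoetherian 𝒪[E] M) F
  have haM' : ∀ k : ℕ, (((a⁻¹ ^ k : LinearMap.GeneralLinearGroup E V)) : Module.End E V) v ∈ M := by
    intro k
    induction k with
    | zero => simpa using hvM
    | succ k ih =>
      rw [pow_succ', Units.val_mul]
      exact haM _ ih
  have h1 : (⟨_, haM' (n + 1)⟩ : M) ∈ F (n + 1) := by
    change ((a : Module.End E V) ^ (n + 1))
      ((((a⁻¹ ^ (n + 1) : LinearMap.GeneralLinearGroup E V)) : Module.End E V) v) ∈ N
    rw [← Units.val_pow_eq_pow_val, inv_pow, units_apply_inv_self]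
    exact hvN
  rw [← hn (n + 1) n.le_succ] at h1
  change ((a : Module.End E V) ^ n)
      ((((a⁻¹ ^ (n + 1) : LinearMap.GeneralLinearGroup E V)) : Module.End E V) v) ∈ N at h1
  rw [pow_succ, Units.val_mul, ← Units.val_pow_eq_pow_val, inv_pow] at h1
  change ((a ^ n : LinearMap.GeneralLinearGroup E V) : Module.End E V)
    ((((a ^ n)⁻¹ : LinearMap.GeneralLinearGroup E V) : Module.End E V)
      (((a⁻¹ : LinearMap.GeneralLinearGroup E V) : Module.End E V) v)) ∈ N at h1
  rwa [units_apply_inv_self] at h1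

/-- An element of `End⁰(L)` that is a unit of the order of another lattice chain is a unit of
`End⁰(L)`. -/
theorem mem_U_of_mem_order {Λ' : LatticeChain E V} {a : LinearMap.GeneralLinearGroup E V}
    (ha : (a : Module.End E V) ∈ Λ.order)
    (ha' : ((a⁻¹ : LinearMap.GeneralLinearGroup E V) : Module.End E V) ∈ Λ'.order) :
    a ∈ U Λ.order := by
  refine mem_U_iff.mpr ⟨ha, fun i v hv ↦ ?_⟩
  obtain ⟨j, hj⟩ := Λ'.isFiltration.exhaust v
  exact inv_apply_mem (Λ'.isLattice j).fg (ha i) (ha' j) hv hj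

theorem conj_mem_order_iff {x : LinearMap.GeneralLinearGroup E V} {g : Module.End E V} :
    ((x⁻¹ : LinearMap.GeneralLinearGroup E V) : Module.End E V) * g * (x : Module.End E V)
      ∈ Λ.order ↔ ∀ i, ∀ v ∈ translate Λ.L x i, g v ∈ translate Λ.L x i := by
  constructor
  · intro h i v hv
    have := h i _ (mem_translate.mp hv)
    rw [Module.End.mul_apply, units_apply_inv_self] at this
    exact this
  · intro h i v hv
    have := h i ((x : Module.End E V) v) (by rwa [mem_translate, units_inv_apply_self])
    exact this

end LatticeChain

/-! ### Coordinates with respect to a splitting basis -/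

/-- An endomorphism maps one module defined by conditions on the coordinates into another one as
soon as its matrix coefficients do. -/
theorem repr_apply_mem {R K M ι : Type*} [Ring R] [Field K] [Module R K] [AddCommGroup M]
    [Module K M] [Fintype ι] (b : Module.Basis ι K M) (y : Module.End K M)
    {A : ι → Submodule R K} {A' : Submodule R K} {t : ι}
    (h : ∀ t', ∀ d ∈ A t', d * b.repr (y (b t')) t ∈ A') {v : M} (hv : ∀ t', b.repr v t' ∈ A t') :
    b.repr (y v) t ∈ A' := by
  have h1 : b.repr (y v) t = ∑ t', b.repr v t' * b.repr (y (b t')) t := by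
    conv_lhs => rw [← b.sum_repr v]
    simp [-Module.Basis.sum_repr, map_sum, Finsupp.finsetSum_apply]
  rw [h1]
  exact sum_mem fun t' _ ↦ h t' _ (hv t')

theorem Splits.basis_mem {e : ℕ} {L : ℤ → Submodule 𝒪[E] V} {ι : Type*}
    {b : Module.Basis ι E V} {α : ι → ℤ} (h : Splits e L b α) {i : ℤ} {t : ι} (hi : i ≤ α t) :
    b t ∈ L i := by
  classical
  rw [h i]
  intro t'
  rw [Module.Basis.repr_self, Finsupp.single_apply]
  split_ifs with ht
  · rw [← ht]
    exact fracIdeal_antitone e (by linarith) (one_mem_fracIdeal_zero e)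
  · exact zero_mem _

theorem Splits.repr_apply_basis_mem {e : ℕ} {L M : ℤ → Submodule 𝒪[E] V} {ι : Type*}
    {b : Module.Basis ι E V} {α β : ι → ℤ} (h : Splits e L b α) (h' : Splits e M b β)
    {y : Module.End E V} {i j : ℤ} (hy : ∀ v ∈ L i, y v ∈ M j) {t' : ι} (hi : i ≤ α t') (t : ι) :
    b.repr (y (b t')) t ∈ fracIdeal E e (j - β t) :=
  (h' j _).mp (hy _ (h.basis_mem hi)) t

theorem Splits.apply_mem {e : ℕ} {L : ℤ → Submodule 𝒪[E] V} {ι : Type*} [Fintype ι]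
    {b : Module.Basis ι E V} {α : ι → ℤ} (h : Splits e L b α) {y : Module.End E V}
    (hy : ∀ t t', b.repr (y (b t')) t ∈ fracIdeal E e (α t' - α t)) (i : ℤ) {v : V}
    (hv : v ∈ L i) : y v ∈ L i := by
  rw [h i] at hv ⊢
  intro t
  refine repr_apply_mem b y (fun t' d hd ↦ ?_) hv
  have := mul_mem_fracIdeal hd (hy t t')
  simpa using this

/-! ### Monomial automorphisms -/

section Monomial

variable {e f : ℕ} [NeZero e] (b : Module.Basis (Fin e × Fin f) E V)

/-- The endomorphism attached to `p : ℤ → ℤ`: writing `b (m, a)` for `ϖ ^ k b (j, a)` if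
`m = j + e k`, it maps `b (j, a)` to `b (p j, a)`. -/
def permEnd (p : ℤ → ℤ) : Module.End E V :=
  b.constr E fun t ↦ unif E ^ (p ((t.1 : ℕ) : ℤ) / (e : ℤ)) • b (idx e (p ((t.1 : ℕ) : ℤ)), t.2)

theorem permEnd_basis (p : ℤ → ℤ) (t : Fin e × Fin f) :
    permEnd b p (b t) = unif E ^ (p ((t.1 : ℕ) : ℤ) / (e : ℤ)) •
      b (idx e (p ((t.1 : ℕ) : ℤ)), t.2) :=
  b.constr_basis E _ t

theorem permEnd_zpow_smul_basis {p : ℤ → ℤ} (hp : ∀ m, p (m + e) = p m + e) (m : ℤ) (a : Fin f) :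
    permEnd b p (unif E ^ (m / (e : ℤ)) • b (idx e m, a)) =
      unif E ^ (p m / (e : ℤ)) • b (idx e (p m), a) := by
  conv_rhs => rw [← idx_add_mul_ediv (e := e) m]
  rw [map_smul, permEnd_basis, smul_smul, ← zpow_add₀ unif_ne_zero, map_add_mul hp, idx_add_mul,
    add_mul_ediv, add_comm]

theorem permEnd_mul {p : ℤ → ℤ} (hp : ∀ m, p (m + e) = p m + e) (q : ℤ → ℤ) :
    permEnd b p * permEnd b q = permEnd b (p ∘ q) := by
  refine b.ext fun t ↦ ?_
  rw [Module.End.mul_apply, permEnd_basis, permEnd_zpow_smul_basis b hp, permEnd_basis]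
  rfl

theorem permEnd_id : permEnd b id = 1 := by
  refine b.ext fun t ↦ ?_
  rw [permEnd_basis, id, idx_coe, ediv_coe, zpow_zero, one_smul]
  rfl

/-- The automorphism attached to a periodic permutation of the integers. -/
def permUnit (p : ℤ ≃ ℤ) (hp : ∀ m, p (m + e) = p m + e) : LinearMap.GeneralLinearGroup E V where
  val := permEnd b p
  inv := permEnd b p.symm
  val_inv := by rw [permEnd_mul b hp, Equiv.self_comp_symm, permEnd_id]
  inv_val := by rw [permEnd_mul b (symm_map_add hp), Equiv.symm_comp_self, permEnd_id]

theorem idx_symm_idx {q : ℤ ≃ ℤ} (hq : ∀ m, q (m + e) = q m + e) (j : Fin e) :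
    ((j : ℕ) : ℤ) =
      q.symm ((idx e (q ((j : ℕ) : ℤ)) : ℕ) : ℤ) + e * (q ((j : ℕ) : ℤ) / (e : ℤ)) := by
  rw [← map_add_mul (symm_map_add hq), idx_add_mul_ediv, Equiv.symm_apply_apply]

/-- A periodic permutation of the integers induces a permutation of the residues modulo `e`. -/
def residuePerm (q : ℤ ≃ ℤ) (hq : ∀ m, q (m + e) = q m + e) : Equiv.Perm (Fin e) where
  toFun j := idx e (q ((j : ℕ) : ℤ))
  invFun j := idx e (q.symm ((j : ℕ) : ℤ))
  left_inv j := by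
    have := congrArg (idx e) (idx_symm_idx hq j)
    rw [idx_coe, idx_add_mul] at this
    exact this.symm
  right_inv j := by
    have := congrArg (idx e) (idx_symm_idx (q := q.symm) (symm_map_add hq) j)
    rw [idx_coe, idx_add_mul] at this
    exact this.symm

theorem permEnd_repr {q : ℤ ≃ ℤ} (hq : ∀ m, q (m + e) = q m + e) (v : V) (t : Fin e × Fin f) :
    b.repr (permEnd b q v) (residuePerm q hq t.1, t.2) =
      unif E ^ (q ((t.1 : ℕ) : ℤ) / (e : ℤ)) * b.repr v t := by
  classical
  suffices h : b.coord (residuePerm q hq t.1, t.2) ∘ₗ permEnd b q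
      = unif E ^ (q ((t.1 : ℕ) : ℤ) / (e : ℤ)) • b.coord t from LinearMap.congr_fun h v
  refine b.ext fun t' ↦ ?_
  have h1 : permEnd b q (b t') = unif E ^ (q ((t'.1 : ℕ) : ℤ) / (e : ℤ)) •
      b (residuePerm q hq t'.1, t'.2) := permEnd_basis b q t'
  rw [LinearMap.comp_apply, h1]
  simp only [map_smul, Module.Basis.coord_apply, Module.Basis.repr_self, LinearMap.smul_apply,
    Finsupp.single_apply, EmbeddingLike.apply_eq_iff_eq, Prod.ext_iff]
  split_ifs with h
  · rw [h.1]
  · simp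

variable {b}

/-- The translate of the standard filtration by a monomial automorphism is again split by the
basis. -/
theorem Splits.translate_permUnit {L : ℤ → Submodule 𝒪[E] V}
    (h : Splits e L b fun t ↦ ((t.1 : ℕ) : ℤ)) {q : ℤ ≃ ℤ} (hq : ∀ m, q (m + e) = q m + e)
    (hq' : ∀ m, q.symm (m + e) = q.symm m + e) :
    Splits e (translate L (permUnit b q.symm hq')) b fun t ↦ q ((t.1 : ℕ) : ℤ) := by
  intro i v
  have h1 : v ∈ translate L (permUnit b q.symm hq') i ↔ permEnd b q v ∈ L i := Iff.rfl
  rw [h1, h i]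
  have h2 : ∀ t : Fin e × Fin f, (b.repr (permEnd b q v) (residuePerm q hq t.1, t.2)
      ∈ fracIdeal E e (i - ((residuePerm q hq t.1 : ℕ) : ℤ))) ↔
      b.repr v t ∈ fracIdeal E e (i - q ((t.1 : ℕ) : ℤ)) := by
    intro t
    rw [permEnd_repr, unif_zpow_mul_mem_fracIdeal_iff, sub_sub]
    have h3 : ((residuePerm q hq t.1 : ℕ) : ℤ) + e * (q ((t.1 : ℕ) : ℤ) / (e : ℤ))
        = q ((t.1 : ℕ) : ℤ) := idx_add_mul_ediv _
    rw [h3]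
  constructor
  · exact fun h t ↦ (h2 t).mp (h (residuePerm q hq t.1, t.2))
  · intro h t
    have := (h2 ((residuePerm q hq).symm t.1, t.2)).mpr (h _)
    simpa only [Equiv.apply_symm_apply] using this

end Monomial

/-! ### Larger hereditary orders and block-increasing monomial automorphisms -/

namespace LatticeChain

variable {Λ₀ Λ : LatticeChain E V} {f : ℕ} {b : Module.Basis (Fin Λ₀.period × Fin f) E V}

/-- A lattice stable under the order of a chain is a member of the chain, since the order maps any
vector of `L s` outside `L (s + 1)` onto all of `L s`. -/
theorem exists_L_eq_of_order_le (hb : Splits Λ₀.period Λ₀.L b fun t ↦ ((t.1 : ℕ) : ℤ))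
    (hle : Λ₀.order ≤ Λ.order) (i : ℤ) : ∃ s, Λ.L i = Λ₀.L s := by
  have hΛ₀ := Λ₀.isFiltration
  obtain ⟨v₀, hv₀, hv₀'⟩ := SetLike.exists_of_lt (Λ.strictAnti (lt_add_one i))
  have hv₀0 : v₀ ≠ 0 := fun h ↦ hv₀' (h ▸ zero_mem _)
  obtain ⟨r, hr⟩ := hΛ₀.exists_notMem hv₀0
  obtain ⟨s, hs, hmax⟩ := Int.exists_greatest_of_bdd (P := fun s ↦ Λ.L i ≤ Λ₀.L s)
    ⟨r, fun z hz ↦ not_lt.mp fun h ↦ hr (hΛ₀.antitone h.le (hz hv₀))⟩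
    (exists_fg_le hΛ₀.antitone hΛ₀.exhaust (Λ.isLattice i).fg)
  refine ⟨s, le_antisymm hs fun z hz ↦ ?_⟩
  obtain ⟨v, hv, hv'⟩ := SetLike.not_le_iff_exists.mp
    fun h : Λ.L i ≤ Λ₀.L (s + 1) ↦ absurd (hmax _ h) (by simp)
  rw [hb (s + 1)] at hv'
  push Not at hv'
  obtain ⟨t, ht⟩ := hv'
  have ht' := (hb s v).mp (hs hv) t
  rw [mem_fracIdeal, not_or] at ht
  have h1 := ht'.resolve_left ht.1
  have hinv : (b.repr v t)⁻¹ ∈ fracIdeal E Λ₀.period (((t.1 : ℕ) : ℤ) - s) := by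
    right
    rw [← zpow_neg_one, ord_zpow]
    linarith [not_le.mp ht.2]
  let y : Module.End E V := ((b.repr v t)⁻¹ • b.coord t).smulRight z
  have hy : y ∈ Λ₀.order := by
    intro m u hu
    have := hΛ₀.smul_mem (mul_mem_fracIdeal hinv ((hb m u).mp hu t)) hz
    rw [show s + (((t.1 : ℕ) : ℤ) - s + (m - ((t.1 : ℕ) : ℤ))) = m by ring] at this
    exact this
  have := hle hy i v hv
  have hyv : y v = z := by
    change ((b.repr v t)⁻¹ * b.repr v t) • z = z
    rw [inv_mul_cancel₀ ht.1, one_smul]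
  rwa [hyv] at this

/-- The chain `Λ` is obtained from `Λ₀` by omitting lattices: `Λ.L i = Λ₀.L (s i)`, and `B m` is the
number of the last lattice of `Λ` containing `Λ₀.L m`. -/
structure IsCoarsening (Λ₀ Λ : LatticeChain E V) (s B : ℤ → ℤ) : Prop where
  L_eq : ∀ i, Λ.L i = Λ₀.L (s i)
  le_iff : ∀ i m, s i ≤ m ↔ i ≤ B m
  map_add : ∀ m, B (m + Λ₀.period) = B m + Λ.period

theorem exists_isCoarsening (hb : Splits Λ₀.period Λ₀.L b fun t ↦ ((t.1 : ℕ) : ℤ))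
    (hle : Λ₀.order ≤ Λ.order) : ∃ s B, IsCoarsening Λ₀ Λ s B := by
  choose s hs using exists_L_eq_of_order_le hb hle
  have hmono : StrictMono s := by
    intro i j hij
    have := Λ.strictAnti hij
    rwa [hs, hs, Λ₀.strictAnti.lt_iff_gt] at this
  have hper : ∀ i, s (i + Λ.period) = s i + Λ₀.period := by
    intro i
    apply Λ₀.strictAnti.injective
    rw [← hs, Λ.periodic, Λ₀.periodic, hs]
  obtain ⟨B, hB⟩ := exists_block_function hmono
  refine ⟨s, B, hs, hB, fun m ↦ ?_⟩
  have h1 : ∀ i, i ≤ B (m + Λ₀.period) ↔ i ≤ B m + Λ.period := by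
    intro i
    have h2 := hper (i - Λ.period)
    rw [sub_add_cancel] at h2
    rw [← hB, h2, add_le_add_iff_right, hB, sub_le_iff_le_add]
  exact le_antisymm ((h1 _).mp le_rfl) ((h1 _).mpr le_rfl)

variable {s B : ℤ → ℤ}

theorem IsCoarsening.monotone (hc : IsCoarsening Λ₀ Λ s B) : Monotone B :=
  fun _ _ h ↦ (hc.le_iff _ _).mp (((hc.le_iff _ _).mpr le_rfl).trans h)

theorem IsCoarsening.map_add_mul (hc : IsCoarsening Λ₀ Λ s B) (m k : ℤ) :
    B (m + Λ₀.period * k) = B m + Λ.period * k :=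
  HereditaryOrder.map_add_mul hc.map_add m k

/-- Whether a component in degree `m` satisfies the condition for `Λ.L i` depends only on the
block `B m`. -/
theorem IsCoarsening.mem_fracIdeal_iff (hc : IsCoarsening Λ₀ Λ s B) {i m : ℤ} {c : E} :
    c ∈ fracIdeal E Λ₀.period (s i - m) ↔ c = 0 ∨ i ≤ B m + Λ.period * ord c := by
  rw [mem_fracIdeal, sub_le_iff_le_add', hc.le_iff, hc.map_add_mul]

theorem IsCoarsening.translate_eq (hc : IsCoarsening Λ₀ Λ s B)
    (w : LinearMap.GeneralLinearGroup E V) (i : ℤ) :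
    translate Λ.L w i = translate Λ₀.L w (s i) :=
  congrArg (Submodule.comap _) (hc.L_eq i)

theorem inv_mul_mem_U {x w : LinearMap.GeneralLinearGroup E V}
    (h : ∀ i, translate Λ.L x i = translate Λ.L w i) : x⁻¹ * w ∈ U Λ.order := by
  rw [mem_U_iff]
  constructor
  · intro i v hv
    have : (w : Module.End E V) v ∈ translate Λ.L x i := by
      rwa [h, mem_translate, units_inv_apply_self]
    exact this
  · intro i v hv
    have : (x : Module.End E V) v ∈ translate Λ.L w i := by
      rwa [← h, mem_translate, units_inv_apply_self]
    rw [mul_inv_rev, inv_inv]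
    exact this

/-- If the chain `x Λ₀` is split with degrees given by `π`, and `q` has values in the same blocks as
`π`, then the monomial automorphism attached to `q⁻¹` lies in `x U(𝔅)`. -/
theorem IsCoarsening.inv_mul_permUnit_mem (hc : IsCoarsening Λ₀ Λ s B)
    (hb : Splits Λ₀.period Λ₀.L b fun t ↦ ((t.1 : ℕ) : ℤ)) {x : LinearMap.GeneralLinearGroup E V}
    {π : ℤ → ℤ} (hx : Splits Λ₀.period (translate Λ₀.L x) b fun t ↦ π ((t.1 : ℕ) : ℤ))
    {q : ℤ ≃ ℤ} (hq : ∀ m, q (m + Λ₀.period) = q m + Λ₀.period)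
    (hq' : ∀ m, q.symm (m + Λ₀.period) = q.symm m + Λ₀.period) (hqπ : ∀ m, B (q m) = B (π m)) :
    x⁻¹ * permUnit b q.symm hq' ∈ U Λ.order := by
  refine inv_mul_mem_U fun i ↦ ?_
  ext v
  rw [hc.translate_eq, hc.translate_eq, hx, hb.translate_permUnit hq hq']
  simp only [hc.mem_fracIdeal_iff, hqπ]

/-- If `q` is increasing as long as its values stay in one block, and `w` is the monomial
automorphism attached to `q⁻¹`, then `U(𝔅₀) ∩ U(𝔅) ^ w` is contained in `U(𝔅₀) ^ w`. -/
theorem IsCoarsening.conj_mem_order (hc : IsCoarsening Λ₀ Λ s B)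
    (hb : Splits Λ₀.period Λ₀.L b fun t ↦ ((t.1 : ℕ) : ℤ))
    {q : ℤ ≃ ℤ} (hq : ∀ m, q (m + Λ₀.period) = q m + Λ₀.period)
    (hq' : ∀ m, q.symm (m + Λ₀.period) = q.symm m + Λ₀.period)
    (hsort : ∀ m m', B (q m) = B (q m') → m < m' → q m < q m')
    {w : LinearMap.GeneralLinearGroup E V} (hw : w = permUnit b q.symm hq')
    {g : Module.End E V} (hg : g ∈ Λ₀.order)
    (hgw : ((w⁻¹ : LinearMap.GeneralLinearGroup E V) : Module.End E V) * g * (w : Module.End E V)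
      ∈ Λ.order) :
    ((w⁻¹ : LinearMap.GeneralLinearGroup E V) : Module.End E V) * g * (w : Module.End E V)
      ∈ Λ₀.order := by
  have hbw : Splits Λ₀.period (translate Λ₀.L w) b fun t ↦ q ((t.1 : ℕ) : ℤ) := by
    rw [hw]
    exact hb.translate_permUnit hq hq'
  rw [conj_mem_order_iff] at hgw ⊢
  refine fun i v hv ↦ hbw.apply_mem (fun t t' ↦ ?_) i hv
  have h1 := hb.repr_apply_basis_mem hb (hg ((t'.1 : ℕ) : ℤ)) le_rfl t
  have h2 := hbw.repr_apply_basis_mem hbw (i := s (B (q ((t'.1 : ℕ) : ℤ))))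
    (j := s (B (q ((t'.1 : ℕ) : ℤ)))) (fun v hv ↦ by
      have := hgw (B (q ((t'.1 : ℕ) : ℤ))) v
      rw [hc.translate_eq] at this
      exact this hv) ((hc.le_iff _ _).mpr le_rfl) t
  set c := b.repr (g (b t')) t
  rw [hc.mem_fracIdeal_iff] at h2
  by_cases hc0 : c = 0
  · exact Or.inl hc0
  right
  -- `m` is the degree of the component of `g (b t')` along `b t`
  set m := ((t.1 : ℕ) : ℤ) + Λ₀.period * ord c with hm
  have h1' : ((t'.1 : ℕ) : ℤ) ≤ m := by
    have := h1.resolve_left hc0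
    linarith
  have hqm : q m = q ((t.1 : ℕ) : ℤ) + Λ₀.period * ord c := HereditaryOrder.map_add_mul hq _ _
  have h2' : B (q ((t'.1 : ℕ) : ℤ)) ≤ B (q m) := by
    rw [hqm, hc.map_add_mul]
    exact h2.resolve_left hc0
  suffices h : q ((t'.1 : ℕ) : ℤ) ≤ q m by linarith
  by_contra! h
  rcases h1'.lt_or_eq with h3 | h3
  · exact absurd (hsort _ _ (le_antisymm h2' (hc.monotone h.le)) h3) (not_lt.mpr h.le)
  · rw [h3] at h
    exact lt_irrefl _ h

/-- With `w` as before, `U(𝔅₀) ^ w` is contained in `(U(𝔅₀) ∩ U(𝔅₀) ^ w) U¹(𝔅) ^ w`: an element of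
`U(𝔅₀)` is modified by an element of `U¹(𝔅)` when the matrix coefficients leading from one block
to another are replaced by `0`. -/
theorem IsCoarsening.exists_conj_mul [FiniteDimensional E V] (hc : IsCoarsening Λ₀ Λ s B)
    (hb : Splits Λ₀.period Λ₀.L b fun t ↦ ((t.1 : ℕ) : ℤ)) (hle : Λ₀.order ≤ Λ.order)
    {q : ℤ ≃ ℤ} (hq : ∀ m, q (m + Λ₀.period) = q m + Λ₀.period)
    (hq' : ∀ m, q.symm (m + Λ₀.period) = q.symm m + Λ₀.period)
    (hsort : ∀ m m', B (q m) = B (q m') → m < m' → q m < q m')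
    {w : LinearMap.GeneralLinearGroup E V} (hw : w = permUnit b q.symm hq')
    {h : LinearMap.GeneralLinearGroup E V} (hh : h ∈ U Λ₀.order) :
    ∃ g ∈ U Λ₀.order, w⁻¹ * g * w ∈ U Λ₀.order ∧
      Λ.IsRadical (((w⁻¹ * g * w)⁻¹ * h : LinearMap.GeneralLinearGroup E V) - 1) := by
  classical
  have hh' := mem_U_iff.mp hh
  have hcoef : ∀ t t', b.repr ((h : Module.End E V) (b t')) t ∈
      fracIdeal E Λ₀.period (((t'.1 : ℕ) : ℤ) - ((t.1 : ℕ) : ℤ)) :=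
    fun t t' ↦ hb.repr_apply_basis_mem hb (hh'.1 _) le_rfl t
  -- the condition that a coefficient leads to a later block
  let P : Fin Λ₀.period × Fin f → Fin Λ₀.period × Fin f → Prop := fun t t' ↦
    b.repr ((h : Module.End E V) (b t')) t ∈
      fracIdeal E Λ₀.period (s (B ((t'.1 : ℕ) : ℤ) + 1) - ((t.1 : ℕ) : ℤ))
  let a : Module.End E V := b.constr E fun t' ↦ b.equivFun.symm fun t ↦
    if P t t' then 0 else b.repr ((h : Module.End E V) (b t')) t
  have ha : ∀ t t', b.repr (a (b t')) t =
      if P t t' then 0 else b.repr ((h : Module.End E V) (b t')) t := by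
    intro t t'
    rw [Module.Basis.constr_basis, ← b.equivFun_apply, LinearEquiv.apply_symm_apply]
  have haord : a ∈ Λ₀.order := by
    refine fun i v hv ↦ hb.apply_mem (fun t t' ↦ ?_) i hv
    rw [ha]
    split_ifs
    · exact zero_mem _
    · exact hcoef t t'
  have hrad : Λ.IsRadical ((h : Module.End E V) - a) := by
    intro i v hv
    rw [hc.L_eq, hb] at hv
    rw [hc.L_eq, hb]
    intro t
    refine repr_apply_mem b _ (fun t' d hd ↦ ?_) hv
    rw [LinearMap.sub_apply, map_sub, Finsupp.sub_apply, ha]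
    split_ifs with hP
    · rw [sub_zero]
      have hP' := hc.mem_fracIdeal_iff.mp hP
      rw [hc.mem_fracIdeal_iff] at hd ⊢
      set c := b.repr ((h : Module.End E V) (b t')) t
      by_cases hd0 : d = 0
      · exact Or.inl (by rw [hd0, zero_mul])
      by_cases hc0 : c = 0
      · exact Or.inl (by rw [hc0, mul_zero])
      right
      rw [ord_mul hd0 hc0, mul_add]
      have h1 := hd.resolve_left hd0
      have h2 := hP'.resolve_left hc0
      linarith
    · rw [sub_self, mul_zero]
      exact zero_mem _
  obtain ⟨r, hr, hr'⟩ := IsRadical.exists_eq_one_add (Λ := Λ)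
    (r := -(((h⁻¹ : LinearMap.GeneralLinearGroup E V) : Module.End E V) * (h - a)))
    (fun i v hv ↦ neg_mem (hrad.mul_left (hle hh'.2) i v hv))
  -- the truncation `a` is a unit
  have hhr : ((h * r : LinearMap.GeneralLinearGroup E V) : Module.End E V) = a := by
    rw [Units.val_mul, hr', mul_add, mul_one, mul_neg, Units.mul_inv_cancel_left]
    abel
  have hhrU : h * r ∈ U Λ.order := mul_mem (Submonoid.units_mono hle hh) hr
  have hhrU' := (mem_U_iff.mp hhrU).2
  refine ⟨w * (h * r) * w⁻¹, ?_, ?_, ?_⟩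
  · have hbw : Splits Λ₀.period (translate Λ₀.L w⁻¹) b fun t ↦ q.symm ((t.1 : ℕ) : ℤ) := by
      have h1 : w⁻¹ = permUnit b q.symm.symm hq := by
        rw [hw]
        rfl
      rw [h1]
      exact hb.translate_permUnit (q := q.symm) hq' hq
    have key : ∀ i, ∀ v ∈ translate Λ₀.L w⁻¹ i, a v ∈ translate Λ₀.L w⁻¹ i := by
      refine fun i v hv ↦ hbw.apply_mem (fun t t' ↦ ?_) i hv
      rw [ha]
      split_ifs with hP
      · exact zero_mem _
      · have h1 := hcoef t t'
        simp only [P, hc.mem_fracIdeal_iff, not_or] at hP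
        set c := b.repr ((h : Module.End E V) (b t')) t
        have h1' := h1.resolve_left hP.1
        have hBle : B (((t.1 : ℕ) : ℤ) + Λ₀.period * ord c) ≤ B ((t'.1 : ℕ) : ℤ) := by
          rw [hc.map_add_mul]
          have := hP.2
          omega
        have hle' : ((t'.1 : ℕ) : ℤ) ≤ ((t.1 : ℕ) : ℤ) + Λ₀.period * ord c := by linarith
        have hBeq := le_antisymm hBle (hc.monotone hle')
        right
        suffices hs : q.symm ((t'.1 : ℕ) : ℤ) ≤ q.symm (((t.1 : ℕ) : ℤ) + Λ₀.period * ord c) by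
          rw [HereditaryOrder.map_add_mul hq'] at hs
          linarith
        by_contra! hlt
        have := hsort _ _ (by rw [Equiv.apply_symm_apply, Equiv.apply_symm_apply, hBeq]) hlt
        rw [Equiv.apply_symm_apply, Equiv.apply_symm_apply] at this
        exact absurd this (not_lt.mpr hle')
    refine mem_U_iff.mpr ⟨?_, ?_⟩
    · have := (conj_mem_order_iff (Λ := Λ₀) (x := w⁻¹)).mpr key
      rw [inv_inv] at this
      rw [Units.val_mul, Units.val_mul, hhr]
      exact this
    · have := (conj_mem_order_iff (Λ := Λ₀) (x := w⁻¹) (g := (((h * r)⁻¹ :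
        LinearMap.GeneralLinearGroup E V) : Module.End E V))).mpr (by
          intro i v hv
          obtain ⟨j, hj⟩ := Λ.isFiltration.exhaust v
          refine inv_apply_mem (Λ.isLattice j).fg (a := h * r) ?_ (hhrU' j) hv hj
          rw [hhr]
          exact key i)
      rw [inv_inv] at this
      have h2 : (w * (h * r) * w⁻¹)⁻¹ = w * (h * r)⁻¹ * w⁻¹ := by group
      rw [h2, Units.val_mul, Units.val_mul]
      exact this
  · have h1 : w⁻¹ * (w * (h * r) * w⁻¹) * w = h * r := by group
    rw [h1]
    exact mem_U_of_mem_order (by rw [hhr]; exact haord) hhrU'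
  · have h1 : w⁻¹ * (w * (h * r) * w⁻¹) * w = h * r := by group
    rw [h1]
    have h2 : (((h * r)⁻¹ * h : LinearMap.GeneralLinearGroup E V) : Module.End E V) - 1
        = (((h * r)⁻¹ : LinearMap.GeneralLinearGroup E V) : Module.End E V) * (h - a) := by
      rw [mul_sub, ← hhr, Units.inv_mul, Units.val_mul]
    rw [h2]
    exact hrad.mul_left hhrU'

theorem IsCoarsening.isRadical (hc : IsCoarsening Λ₀ Λ s B) {r : Module.End E V}
    (hr : Λ.IsRadical r) : Λ₀.IsRadical r := by
  intro m v hv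
  have h1 := hr (B m) v (by
    rw [hc.L_eq]
    exact Λ₀.strictAnti.antitone ((hc.le_iff _ _).mpr le_rfl) hv)
  rw [hc.L_eq] at h1
  refine Λ₀.strictAnti.antitone ?_ h1
  have : ¬ s (B m + 1) ≤ m := by
    rw [hc.le_iff]
    omega
  omega

end LatticeChain

/-! ### Tensor powers of a cuspidal representation -/

section TensorPower

variable {G : Type*} [Group G] {W : Type*} [AddCommGroup W] [Module ℂ W] {e : ℕ}

theorem tensorPower_tprod (π : Representation ℂ G W) (g : Fin e → G) (v : Fin e → W) :
    tensorPower π e g (PiTensorProduct.tprod ℂ v) =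
      PiTensorProduct.tprod ℂ fun i ↦ π (g i) (v i) :=
  PiTensorProduct.map_tprod _ _

/-- A permutation of the tensor factors intertwines an outer tensor power with its twist by the
permutation. -/
theorem reindex_tensorPower (π : Representation ℂ G W) (σ : Equiv.Perm (Fin e)) (g : Fin e → G)
    (y : ⨂[ℂ] _ : Fin e, W) :
    PiTensorProduct.reindex ℂ (fun _ ↦ W) σ.symm (tensorPower π e g y) =
      tensorPower π e (g ∘ σ) (PiTensorProduct.reindex ℂ (fun _ ↦ W) σ.symm y) := by
  suffices h : (PiTensorProduct.reindex ℂ (fun _ ↦ W) σ.symm).toLinearMap ∘ₗ tensorPower π e g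
      = tensorPower π e (g ∘ σ) ∘ₗ (PiTensorProduct.reindex ℂ (fun _ ↦ W) σ.symm).toLinearMap from
    LinearMap.congr_fun h y
  refine PiTensorProduct.ext (MultilinearMap.ext fun v ↦ ?_)
  simp only [LinearMap.compMultilinearMap_apply, LinearMap.comp_apply, LinearEquiv.coe_coe,
    tensorPower_tprod, PiTensorProduct.reindex_tprod, Equiv.symm_symm]
  rfl

variable {k : Type*} [Field k] {f : ℕ}

theorem mul_mem_unipotentRadical {c : Fin f → ℕ} {g h : GL (Fin f) k}
    (hg : g ∈ unipotentRadical c) (hh : h ∈ unipotentRadical c) :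
    g * h ∈ unipotentRadical c := by
  intro i j hij
  by_contra hc
  apply hij
  rw [Units.val_mul, Matrix.mul_apply]
  have hg' : ∀ i j, ¬ c i < c j → (g : Matrix (Fin f) (Fin f) k) i j
      = (1 : Matrix (Fin f) (Fin f) k) i j := fun i j h ↦ by_contra fun h' ↦ h (hg i j h')
  have hh' : ∀ i j, ¬ c i < c j → (h : Matrix (Fin f) (Fin f) k) i j
      = (1 : Matrix (Fin f) (Fin f) k) i j := fun i j h ↦ by_contra fun h' ↦ h (hh i j h')
  have hterm : ∀ l, (g : Matrix (Fin f) (Fin f) k) i l * (h : Matrix (Fin f) (Fin f) k) l j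
      = if l = i then (1 : Matrix (Fin f) (Fin f) k) i j else 0 := by
    intro l
    by_cases hil : c i < c l
    · have hlj : ¬ c l < c j := fun h ↦ hc (hil.trans h)
      have hli : l ≠ i := fun h ↦ by simp [h] at hil
      have hlj' : l ≠ j := fun h ↦ hc (h ▸ hil)
      rw [hh' l j hlj, Matrix.one_apply_ne hlj', mul_zero, if_neg hli]
    · rw [hg' i l hil]
      split_ifs with hli
      · rw [hli, Matrix.one_apply_eq, one_mul, hh' i j hc]
      · rw [Matrix.one_apply_ne' hli, zero_mul]
  simp [hterm]

/-- A linear map on the outer tensor power of a cuspidal representation that is invariant under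
the action of the unipotent radical of a proper parabolic subgroup on one tensor factor is zero:
averaging over the unipotent radical produces a fixed vector. -/
theorem IsCuspidal.eq_zero_of_invariant [Finite k] {π : Representation ℂ (GL (Fin f) k) W}
    (hπ : IsCuspidal π) {c : Fin f → ℕ} (hc : ∃ i j, c i ≠ c j) {X : Type*} [AddCommGroup X]
    [Module ℂ X] (S : (⨂[ℂ] _ : Fin e, W) →ₗ[ℂ] X) (j : Fin e)
    (hS : ∀ g ∈ unipotentRadical (k := k) c, ∀ y,
      S (tensorPower π e (Pi.mulSingle j g) y) = S y) : S = 0 := by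
  classical
  refine PiTensorProduct.ext (MultilinearMap.ext fun v ↦ ?_)
  let S' : W →ₗ[ℂ] X := (S.compMultilinearMap (PiTensorProduct.tprod ℂ)).toLinearMap v j
  have hS' : ∀ g ∈ unipotentRadical (k := k) c, ∀ w, S' (π g w) = S' w := by
    intro g hg w
    have := hS g hg (PiTensorProduct.tprod ℂ (Function.update v j w))
    rw [tensorPower_tprod] at this
    change S (PiTensorProduct.tprod ℂ (Function.update v j (π g w))) =
      S (PiTensorProduct.tprod ℂ (Function.update v j w))
    rw [← this]
    congr 2
    funext i
    by_cases hi : i = j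
    · subst hi
      simp
    · simp [hi]
  let N := (Set.toFinite (unipotentRadical (k := k) c)).toFinset
  have hN : ∀ g, g ∈ N ↔ g ∈ unipotentRadical (k := k) c := fun g ↦ Set.Finite.mem_toFinset _
  have hsum : ∑ g ∈ N, π g (v j) = 0 := by
    refine hπ.eq_zero_of_fixed c hc _ fun h hh ↦ ?_
    have himg : N.image (h * ·) = N := by
      refine Finset.eq_of_subset_of_card_le (fun g hg ↦ ?_) ?_
      · obtain ⟨g', hg', rfl⟩ := Finset.mem_image.mp hg
        exact (hN _).mpr (mul_mem_unipotentRadical hh ((hN _).mp hg'))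
      · rw [Finset.card_image_of_injective _ (mul_right_injective h)]
    rw [map_sum]
    conv_rhs => rw [← himg, Finset.sum_image fun _ _ _ _ h' ↦ mul_right_injective h h']
    exact Finset.sum_congr rfl fun g _ ↦ by rw [map_mul, Module.End.mul_apply]
  have h1 : (N.card : ℂ) • S' (v j) = 0 := by
    rw [← map_zero S', ← hsum, map_sum, Finset.sum_congr rfl fun g hg ↦ hS' g ((hN g).mp hg) (v j),
      Finset.sum_const, Nat.cast_smul_eq_nsmul]
  have hcard : (N.card : ℂ) ≠ 0 := by
    have : (1 : GL (Fin f) k) ∈ N := (hN _).mpr fun i j h ↦ absurd rfl h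
    exact_mod_cast (Finset.card_pos.mpr ⟨_, this⟩).ne'
  have h2 := (smul_eq_zero.mp h1).resolve_left hcard
  change S (PiTensorProduct.tprod ℂ (Function.update v j (v j))) = 0 at h2
  rw [Function.update_eq_self] at h2
  exact h2

end TensorPower

/-! ### Reduction with respect to an adapted basis -/

namespace LatticeChain

variable {Λ : LatticeChain E V} {f : ℕ}

/-- For any two framings there is an element of `∏ GL_f(k_E)` conjugating the reductions. -/
theorem exists_reduction_conj (φ φ' : Λ.Framing f) :
    ∃ P : Fin Λ.period → GL (Fin f) 𝓀[E], ∀ u, Λ.reduction φ' u = P * Λ.reduction φ u * P⁻¹ := by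
  let M : ((Fin f → 𝓀[E]) ≃ₗ[𝒪[E]] (Fin f → 𝓀[E])) → Matrix (Fin f) (Fin f) 𝓀[E] :=
    fun A ↦ LinearMap.toMatrix'
      ((A : (Fin f → 𝓀[E]) →ₗ[𝒪[E]] (Fin f → 𝓀[E])).extendScalarsOfSurjective
        algebraMap_residue_surjective)
  have hM : ∀ A v, (M A).mulVec v = A v := by
    intro A v
    rw [LinearMap.toMatrix'_mulVec]
    rfl
  have hext : ∀ A B : Matrix (Fin f) (Fin f) 𝓀[E], (∀ v, A.mulVec v = B.mulVec v) → A = B :=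
    fun A B h ↦ Matrix.toLin'.injective (LinearMap.ext h)
  let A : ∀ i : Fin Λ.period, (Fin f → 𝓀[E]) ≃ₗ[𝒪[E]] (Fin f → 𝓀[E]) :=
    fun i ↦ (φ i).symm.trans (φ' i)
  let P : Fin Λ.period → GL (Fin f) 𝓀[E] := fun i ↦
    { val := M (A i)
      inv := M (A i).symm
      val_inv := hext _ _ fun v ↦ by
        rw [← Matrix.mulVec_mulVec, hM, hM, Matrix.one_mulVec, LinearEquiv.apply_symm_apply]
      inv_val := hext _ _ fun v ↦ by
        rw [← Matrix.mulVec_mulVec, hM, hM, Matrix.one_mulVec, LinearEquiv.symm_apply_apply] }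
  refine ⟨P, fun u ↦ ?_⟩
  rw [eq_mul_inv_iff_mul_eq]
  funext i
  refine Units.ext (hext _ _ fun v ↦ ?_)
  obtain ⟨v, rfl⟩ := (φ i).surjective v
  change ((Λ.blockMatrix (φ' i) (unitsEquiv Λ.order u : Λ.orderˣ)) * M (A i)).mulVec _ =
    (M (A i) * (Λ.blockMatrix (φ i) (unitsEquiv Λ.order u : Λ.orderˣ))).mulVec _
  rw [← Matrix.mulVec_mulVec, ← Matrix.mulVec_mulVec, hM, blockMatrix_mulVec, hM]
  simp only [A, LinearEquiv.trans_apply, LinearEquiv.symm_apply_apply]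
  rw [blockMatrix_mulVec]

variable {b : Module.Basis (Fin Λ.period × Fin f) E V}

/-- The framing given by the basis vectors of degree `0, …, e - 1` of an adapted basis. -/
def adaptedFraming (hb : Splits Λ.period Λ.L b fun t ↦ ((t.1 : ℕ) : ℤ)) : Λ.Framing f :=
  fun i ↦ grEquiv (σ := fun a : Fin f ↦ (i, a)) hb Λ.period_pos (fun _ ↦ rfl)
    (Prod.mk_right_injective i) (by
      rintro ⟨j, a⟩ h
      refine ⟨a, Prod.ext (Fin.ext ?_) rfl⟩
      have := eq_of_dvd_sub (by positivity) (by exact_mod_cast i.2) (by positivity)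
        (by exact_mod_cast j.2) h
      exact_mod_cast this)

theorem adaptedFraming_mk (hb : Splits Λ.period Λ.L b fun t ↦ ((t.1 : ℕ) : ℤ))
    (i : Fin Λ.period) (v : Λ.L ((i : ℕ) : ℤ)) (a : Fin f) :
    adaptedFraming hb i (Submodule.Quotient.mk v) a = res (b.repr v (i, a)) := rfl

theorem blockMatrix_adaptedFraming (hb : Splits Λ.period Λ.L b fun t ↦ ((t.1 : ℕ) : ℤ))
    (i : Fin Λ.period) (y : Λ.order) (a c : Fin f) :
    Λ.blockMatrix (adaptedFraming hb i) y a c =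
      res (b.repr ((y : Module.End E V) (b (i, c))) (i, a)) := by
  classical
  have hmem : b (i, c) ∈ Λ.L ((i : ℕ) : ℤ) := hb.basis_mem le_rfl
  have h1 : adaptedFraming hb i (Submodule.Quotient.mk ⟨_, hmem⟩) = Pi.single c 1 := by
    funext a
    rw [adaptedFraming_mk, Module.Basis.repr_self, Finsupp.single_apply, Pi.single_apply]
    by_cases h : a = c
    · rw [if_pos h, if_pos (by rw [h]), res_one]
    · rw [if_neg h, if_neg (by simpa using Ne.symm h), res_zero]
  have h2 := Λ.blockMatrix_mulVec (adaptedFraming hb i) y (Submodule.Quotient.mk ⟨_, hmem⟩)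
  rw [h1, Matrix.mulVec_single_one] at h2
  exact congrFun h2 a

theorem reduction_adaptedFraming_apply (hb : Splits Λ.period Λ.L b fun t ↦ ((t.1 : ℕ) : ℤ))
    (u : U Λ.order) (i : Fin Λ.period) (a c : Fin f) :
    (Λ.reduction (adaptedFraming hb) u i : Matrix (Fin f) (Fin f) 𝓀[E]) a c =
      res (b.repr (((u : (Module.End E V)ˣ) : Module.End E V) (b (i, c))) (i, a)) :=
  blockMatrix_adaptedFraming hb i _ a c

theorem reduction_eq_one (φ : Λ.Framing f) {u : U Λ.order}
    (hu : Λ.IsRadical ((u : (Module.End E V)ˣ) - 1 : Module.End E V)) : Λ.reduction φ u = 1 := by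
  funext i
  refine Units.ext (Matrix.toLin'.injective (LinearMap.ext fun v ↦ ?_))
  obtain ⟨v, rfl⟩ := (φ i).surjective v
  change (Λ.blockMatrix (φ i) (unitsEquiv Λ.order u : Λ.orderˣ)).mulVec _ =
    (1 : Matrix (Fin f) (Fin f) 𝓀[E]).mulVec _
  rw [blockMatrix_mulVec, Matrix.one_mulVec]
  congr 1
  obtain ⟨v, rfl⟩ := Submodule.Quotient.mk_surjective _ v
  exact (Submodule.Quotient.eq _).mpr (hu _ _ v.2)

/-- Conjugation by a monomial automorphism permutes the blocks of the reduction. -/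
theorem reduction_conj_permUnit (hb : Splits Λ.period Λ.L b fun t ↦ ((t.1 : ℕ) : ℤ))
    {q : ℤ ≃ ℤ} (hq : ∀ m, q (m + Λ.period) = q m + Λ.period)
    (hq' : ∀ m, q.symm (m + Λ.period) = q.symm m + Λ.period)
    {w : LinearMap.GeneralLinearGroup E V} (hw : w = permUnit b q.symm hq')
    {g : LinearMap.GeneralLinearGroup E V} (hg : g ∈ U Λ.order)
    (hgw : w⁻¹ * g * w ∈ U Λ.order) :
    Λ.reduction (adaptedFraming hb) ⟨w⁻¹ * g * w, hgw⟩ =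
      Λ.reduction (adaptedFraming hb) ⟨g, hg⟩ ∘ residuePerm q.symm hq' := by
  funext j
  refine Units.ext (Matrix.ext fun a c ↦ ?_)
  rw [Function.comp_apply, reduction_adaptedFraming_apply, reduction_adaptedFraming_apply]
  congr 1
  set j' := residuePerm q.symm hq' j with hj'
  set k := q.symm ((j : ℕ) : ℤ) / (Λ.period : ℤ) with hk
  have h1 : (w : Module.End E V) (b (j, c)) = unif E ^ k • b (j', c) := by
    rw [hw]
    exact permEnd_basis b _ _
  have h2 : ((w⁻¹ : LinearMap.GeneralLinearGroup E V) : Module.End E V) = permEnd b q := by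
    rw [hw]
    rfl
  have h3 : ((j' : ℕ) : ℤ) = q.symm ((j : ℕ) : ℤ) + Λ.period * (-k) := by
    have : ((j' : ℕ) : ℤ) + Λ.period * k = q.symm ((j : ℕ) : ℤ) := idx_add_mul_ediv _
    linarith
  have h4 : q ((j' : ℕ) : ℤ) = ((j : ℕ) : ℤ) + Λ.period * (-k) := by
    rw [h3, HereditaryOrder.map_add_mul hq, Equiv.apply_symm_apply]
  have h5 : residuePerm q hq j' = j := by
    change idx _ (q ((j' : ℕ) : ℤ)) = j
    rw [h4, idx_coe_add_mul]
  have h6 := permEnd_repr b hq ((g : Module.End E V) (b (j', c))) (j', a)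
  rw [h5, h4, ediv_coe_add_mul] at h6
  have h7 : ((w⁻¹ * g * w : LinearMap.GeneralLinearGroup E V) : Module.End E V) (b (j, c))
      = unif E ^ k • permEnd b q ((g : Module.End E V) (b (j', c))) := by
    rw [Units.val_mul, Units.val_mul, Module.End.mul_apply, Module.End.mul_apply, h1, h2,
      map_smul, map_smul]
  rw [h7, map_smul, Finsupp.smul_apply, smul_eq_mul, h6, ← mul_assoc, ← zpow_add₀ unif_ne_zero,
    add_neg_cancel, zpow_zero, one_mul]

end LatticeChain

/-! ### Elements intertwining the cuspidal representation -/

namespace LatticeChain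

variable {Λ : LatticeChain E V} {f : ℕ} {b : Module.Basis (Fin Λ.period × Fin f) E V}

/-- Let the translate `x L` be split by an adapted basis of `L`, with degrees `β`. An element `g` of
`GL_f(k_E)` with `g - 1` strictly raising the degrees `β (j, ·)` lifts to an element of `U(𝔅₀)`
which acts by `g` on the `j`-th graded piece of `L`, trivially on the other ones, and trivially
on all graded pieces of `x L`. -/
theorem exists_unipotent_lift (hb : Splits Λ.period Λ.L b fun t ↦ ((t.1 : ℕ) : ℤ))
    {x : LinearMap.GeneralLinearGroup E V} {β : Fin Λ.period × Fin f → ℤ}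
    (hx : Splits Λ.period (translate Λ.L x) b β) (j : Fin Λ.period) {c : Fin f → ℕ}
    (hc : ∀ a d, c a < c d → β (j, d) < β (j, a)) (hc' : ∀ a, c a = 0 ∨ c a = 1)
    {g : GL (Fin f) 𝓀[E]} (hg : g ∈ unipotentRadical c) :
    ∃ (n : LinearMap.GeneralLinearGroup E V) (hn : n ∈ U Λ.order),
      Λ.reduction (adaptedFraming hb) ⟨n, hn⟩ = Pi.mulSingle j g ∧
        Λ.IsRadical (((x⁻¹ * n * x : LinearMap.GeneralLinearGroup E V) : Module.End E V) - 1) := by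
  classical
  -- a lift of `g - 1` with the same vanishing entries
  have hlift : ∀ a d, ∃ z : 𝒪[E], IsLocalRing.residue 𝒪[E] z
      = (g : Matrix (Fin f) (Fin f) 𝓀[E]) a d - (1 : Matrix (Fin f) (Fin f) 𝓀[E]) a d ∧
      (z ≠ 0 → c a < c d) := by
    intro a d
    by_cases h : (g : Matrix (Fin f) (Fin f) 𝓀[E]) a d = (1 : Matrix (Fin f) (Fin f) 𝓀[E]) a d
    · exact ⟨0, by rw [h, map_zero, sub_self], fun h ↦ absurd rfl h⟩
    · obtain ⟨z, hz⟩ := IsLocalRing.residue_surjective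
        ((g : Matrix (Fin f) (Fin f) 𝓀[E]) a d - (1 : Matrix (Fin f) (Fin f) 𝓀[E]) a d)
      exact ⟨z, hz, fun _ ↦ hg a d h⟩
  choose Z hZ hZc using hlift
  let r : Module.End E V := b.constr E fun t' ↦ b.equivFun.symm fun t ↦
    if t.1 = j ∧ t'.1 = j then (Z t.2 t'.2 : E) else 0
  have hr : ∀ t t', b.repr (r (b t')) t = if t.1 = j ∧ t'.1 = j then (Z t.2 t'.2 : E) else 0 := by
    intro t t'
    rw [Module.Basis.constr_basis, ← b.equivFun_apply, LinearEquiv.apply_symm_apply]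
  have hrord : r ∈ Λ.order := by
    refine fun i v hv ↦ hb.apply_mem (fun t t' ↦ ?_) i hv
    rw [hr]
    split_ifs with h
    · rw [h.1, h.2, sub_self, mem_fracIdeal_zero_iff Λ.period_pos]
      exact (Z t.2 t'.2).2
    · exact zero_mem _
  have hr2 : r * r = 0 := by
    refine b.ext fun t' ↦ b.repr.injective (Finsupp.ext fun t ↦ ?_)
    change b.repr (r (r (b t'))) t = b.repr 0 t
    rw [← b.sum_repr (r (b t')), map_sum, map_sum, Finsupp.finsetSum_apply, map_zero,
      Finsupp.zero_apply]
    refine Finset.sum_eq_zero fun t'' _ ↦ ?_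
    rw [map_smul, map_smul, Finsupp.smul_apply, smul_eq_mul, hr, hr]
    split_ifs with h1 h2
    · by_contra h3
      have h4 : Z t''.2 t'.2 ≠ 0 := fun h ↦ h3 (by rw [h]; simp)
      have h5 : Z t.2 t''.2 ≠ 0 := fun h ↦ h3 (by rw [h]; simp)
      have h6 := hZc _ _ h4
      have h7 := hZc _ _ h5
      rcases hc' t'.2 with h | h <;> omega
    · simp
    · simp
    · simp
  let n : LinearMap.GeneralLinearGroup E V :=
    { val := 1 + r
      inv := 1 - r
      val_inv := by rw [mul_sub, mul_one, add_mul, one_mul, hr2]; abel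
      inv_val := by rw [mul_add, mul_one, sub_mul, one_mul, hr2]; abel }
  have hn : n ∈ U Λ.order := mem_U_iff.mpr
    ⟨Λ.order.add_mem Λ.order.one_mem hrord, Λ.order.sub_mem Λ.order.one_mem hrord⟩
  refine ⟨n, hn, ?_, ?_⟩
  · funext i
    refine Units.ext (Matrix.ext fun a d ↦ ?_)
    rw [reduction_adaptedFraming_apply]
    have h1 : b.repr ((n : Module.End E V) (b (i, d))) (i, a)
        = (((1 : Matrix (Fin f) (Fin f) 𝒪[E]) a d + if i = j then Z a d else 0 : 𝒪[E]) : E) := by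
      change b.repr (b (i, d) + r (b (i, d))) (i, a) = _
      rw [map_add, Finsupp.add_apply, hr, Module.Basis.repr_self, Finsupp.single_apply,
        Matrix.one_apply, Subring.coe_add]
      simp only [Prod.mk.injEq, true_and, and_self, eq_comm (a := d)]
      split_ifs <;> simp
    change res (b.repr ((n : Module.End E V) (b (i, d))) (i, a)) = _
    rw [h1, res_coe, map_add]
    have h2 : IsLocalRing.residue 𝒪[E] ((1 : Matrix (Fin f) (Fin f) 𝒪[E]) a d)
        = (1 : Matrix (Fin f) (Fin f) 𝓀[E]) a d := by
      rw [Matrix.one_apply, Matrix.one_apply]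
      split_ifs <;> simp
    rw [h2]
    by_cases hi : i = j
    · subst hi
      rw [if_pos rfl, hZ, Pi.mulSingle_eq_same]
      abel
    · rw [if_neg hi, map_zero, add_zero, Pi.mulSingle_eq_of_ne hi]
      rfl
  · have hrx : ∀ i, ∀ v ∈ translate Λ.L x i, r v ∈ translate Λ.L x (i + 1) := by
      intro i v hv
      rw [hx] at hv ⊢
      intro t
      refine repr_apply_mem b r (fun t' d hd ↦ ?_) hv
      rw [hr]
      split_ifs with h
      · by_cases hz : Z t.2 t'.2 = 0
        · rw [hz, ZeroMemClass.coe_zero, mul_zero]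
          exact zero_mem _
        · have h1 := hc _ _ (hZc _ _ hz)
          have h2 : (j, t.2) = t := Prod.ext h.1.symm rfl
          have h3 : (j, t'.2) = t' := Prod.ext h.2.symm rfl
          rw [h2, h3] at h1
          have h4 := mul_mem_fracIdeal hd
            ((mem_fracIdeal_zero_iff Λ.period_pos).mpr (Z t.2 t'.2).2)
          exact fracIdeal_antitone _ (by linarith) h4
      · rw [mul_zero]
        exact zero_mem _
    intro i v hv
    have h1 : (((x⁻¹ * n * x : LinearMap.GeneralLinearGroup E V) : Module.End E V) - 1) v
        = ((x⁻¹ : LinearMap.GeneralLinearGroup E V) : Module.End E V)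
          (r ((x : Module.End E V) v)) := by
      change ((x⁻¹ : LinearMap.GeneralLinearGroup E V) : Module.End E V)
        ((x : Module.End E V) v + r ((x : Module.End E V) v)) - v = _
      rw [map_add, units_inv_apply_self]
      abel
    rw [h1]
    exact hrx i _ (by rwa [mem_translate, units_inv_apply_self])

theorem mul_mem_U_of_isRadical {n : LinearMap.GeneralLinearGroup E V} [FiniteDimensional E V]
    (hn : Λ.IsRadical ((n : Module.End E V) - 1)) : n ∈ U Λ.order := by
  obtain ⟨u, hu, hu'⟩ := hn.exists_eq_one_add
  have : u = n := Units.ext (by rw [hu']; abel)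
  rwa [← this]

/-- If there is a nonzero linear map on the tensor power of a cuspidal representation with the
invariance that an intertwining operator for `x` has, then the graded pieces of the chain `L` do
not meet several graded pieces of `x L` in a nontrivial way. -/
theorem degree_eq_of_intertwines (hb : Splits Λ.period Λ.L b fun t ↦ ((t.1 : ℕ) : ℤ))
    {x : LinearMap.GeneralLinearGroup E V} {β : Fin Λ.period × Fin f → ℤ}
    (hx : Splits Λ.period (translate Λ.L x) b β) {W : Type*} [AddCommGroup W] [Module ℂ W]
    {ρ₀ : Representation ℂ (GL (Fin f) 𝓀[E]) W} (hρ₀ : IsCuspidal ρ₀)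
    {X : Type*} [AddCommGroup X] [Module ℂ X] {T : (⨂[ℂ] _ : Fin Λ.period, W) →ₗ[ℂ] X}
    (hT0 : T ≠ 0)
    (hT : ∀ (n : LinearMap.GeneralLinearGroup E V) (hn : n ∈ U Λ.order),
      Λ.IsRadical (((x⁻¹ * n * x : LinearMap.GeneralLinearGroup E V) : Module.End E V) - 1) →
      ∀ y, T (tensorPower ρ₀ Λ.period (Λ.reduction (adaptedFraming hb) ⟨n, hn⟩) y) = T y)
    (j : Fin Λ.period) (a a' : Fin f) : β (j, a) = β (j, a') := by
  have key : ∀ a a', ¬ β (j, a) < β (j, a') := by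
    intro a a' hlt
    apply hT0
    -- the parabolic subgroup stabilizing the vectors of degree at least `β (j, a')`
    let c : Fin f → ℕ := fun d ↦ if β (j, a') ≤ β (j, d) then 0 else 1
    have hca' : c a' = 0 := if_pos le_rfl
    have hca : c a = 1 := if_neg (not_le.mpr hlt)
    refine hρ₀.eq_zero_of_invariant (c := c) ⟨a, a', by rw [hca, hca']; exact one_ne_zero⟩ T j
      fun g hg y ↦ ?_
    obtain ⟨n, hn, hred, hrad⟩ := exists_unipotent_lift hb hx j (c := c) (fun a d h ↦ by
      simp only [c] at h
      split_ifs at h with h1 h2 h3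
      · exact absurd h (lt_irrefl _)
      · exact (not_le.mp h2).trans_le h1
      · exact absurd h (by simp)
      · exact absurd h (lt_irrefl _)) (fun a ↦ by
      simp only [c]
      split_ifs
      · exact Or.inl rfl
      · exact Or.inr rfl) hg
    rw [← hred]
    exact hT n hn hrad y
  exact le_antisymm (not_lt.mp (key a' a)) (not_lt.mp (key a a'))

/-- If the degrees `β (j, a)` of a translate of the chain depend only on `j`, they are the values
of a periodic permutation of the integers: otherwise one of the inclusions in the chain would
not be strict. -/
theorem exists_permutation_of_degree_eq {x : LinearMap.GeneralLinearGroup E V}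
    {β : Fin Λ.period × Fin f → ℤ} (hx : Splits Λ.period (translate Λ.L x) b β)
    (hβ : ∀ j a a', β (j, a) = β (j, a')) :
    ∃ π : ℤ ≃ ℤ, (∀ m, π (m + Λ.period) = π m + Λ.period) ∧
      Splits Λ.period (translate Λ.L x) b fun t ↦ π ((t.1 : ℕ) : ℤ) := by
  have hex : ∀ r : ℤ, ∃ t, (Λ.period : ℤ) ∣ r - β t := by
    intro r
    by_contra! h
    refine (Λ.strictAnti (lt_add_one r)).not_ge fun v hv ↦ ?_
    have h1 : ∀ i, v ∈ Λ.L i ↔ (x : Module.End E V) v ∈ translate Λ.L x i := fun i ↦ by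
      rw [mem_translate, units_inv_apply_self]
    rw [h1, hx] at hv ⊢
    intro t
    rw [show r + 1 - β t = r - β t + 1 by ring, fracIdeal_add_one (h t)]
    exact hv t
  have hf : Nonempty (Fin f) := ⟨(hex 0).choose.2⟩
  obtain ⟨a₀⟩ := hf
  obtain ⟨π, hπ, hπβ⟩ := exists_periodic_extension (fun j ↦ β (j, a₀)) (fun r ↦ by
    obtain ⟨t, ht⟩ := hex r
    exact ⟨t.1, by rwa [hβ t.1 a₀ t.2]⟩)
  refine ⟨π, hπ, ?_⟩
  convert hx using 1
  funext t
  rw [hπβ, hβ t.1 a₀ t.2]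

end LatticeChain

/-! ### Comparison of the spaces of intertwining operators -/

section Comparison

variable {G : Type*} [Group G] {X Y : Type*} [AddCommGroup X] [Module ℂ X]
  [AddCommGroup Y] [Module ℂ Y]

theorem twistedHom_apply {H K : Subgroup G} {ρ : Representation ℂ H X}
    {σ : Representation ℂ K Y} {x : G} (T : TwistedHom ρ σ x) {g : G} (hg : g ∈ H)
    (hgx : x⁻¹ * g * x ∈ K) (v : X) : T (ρ ⟨g, hg⟩ v) = σ ⟨x⁻¹ * g * x, hgx⟩ (T v) :=
  Representation.IntertwiningMap.isIntertwining _ _ T ⟨g, hg, mem_conj_iff.mpr hgx⟩ v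

theorem rep_mul {H : Subgroup G} (ρ : Representation ℂ H X) {g h k : G} (hg : g ∈ H) (hh : h ∈ H)
    (hk : k ∈ H) (he : g * h = k) (v : X) : ρ ⟨g, hg⟩ (ρ ⟨h, hh⟩ v) = ρ ⟨k, hk⟩ v := by
  subst he
  rw [← Module.End.mul_apply, ← map_mul]
  rfl

/-- Let `w ∈ x K` be such that `H ∩ K ^ w` is contained in `H ^ w`, such that `H ^ w` is generated
by `H ∩ H ^ w` and elements acting trivially under both representations, and such that `ρ` and
`ρ ^ w` agree on `H ∩ H ^ w` up to an isomorphism `θ`. Then composition with `θ` identifies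
`Hom_{H ∩ K ^ x}(ρ, τ ^ x)` with `Hom_H(ρ, τ)`. -/
theorem rank_twistedHom_eq {H K : Subgroup G} (hHK : H ≤ K) (ρ : Representation ℂ H X)
    (τ : Representation ℂ K Y) {x w : G} (hn : x⁻¹ * w ∈ K)
    (h1 : ∀ g ∈ H, w⁻¹ * g * w ∈ K → w⁻¹ * g * w ∈ H)
    (h2 : ∀ h ∈ H, ∃ g ∈ H, ∃ _ : w⁻¹ * g * w ∈ H, ∃ hr : (w⁻¹ * g * w)⁻¹ * h ∈ H,
      ρ ⟨_, hr⟩ = 1 ∧ τ ⟨_, hHK hr⟩ = 1)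
    (θ : X ≃ₗ[ℂ] X) (hθ : ∀ (g : G) (hg : g ∈ H) (hgw : w⁻¹ * g * w ∈ H) (v : X),
      θ (ρ ⟨g, hg⟩ v) = ρ ⟨w⁻¹ * g * w, hgw⟩ (θ v)) :
    Module.rank ℂ (TwistedHom ρ τ x) =
      Module.rank ℂ (Representation.IntertwiningMap ρ (restrict hHK τ)) := by
  have hn' : w⁻¹ * x ∈ K := by
    have := inv_mem hn
    rwa [mul_inv_rev, inv_inv] at this
  have hconj : ∀ g, w⁻¹ * g * w ∈ K → x⁻¹ * g * x ∈ K := fun g hg ↦ by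
    have := mul_mem (mul_mem hn hg) hn'
    rwa [show x⁻¹ * w * (w⁻¹ * g * w) * (w⁻¹ * x) = x⁻¹ * g * x by group] at this
  have hconj' : ∀ g, x⁻¹ * g * x ∈ K → w⁻¹ * g * w ∈ K := fun g hg ↦ by
    have := mul_mem (mul_mem hn' hg) hn
    rwa [show w⁻¹ * x * (x⁻¹ * g * x) * (x⁻¹ * w) = w⁻¹ * g * w by group] at this
  have hcancel : ∀ v : Y, τ ⟨x⁻¹ * w, hn⟩ (τ ⟨w⁻¹ * x, hn'⟩ v) = v := fun v ↦ by
    rw [rep_mul τ hn hn' (one_mem K) (by group)]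
    exact LinearMap.congr_fun (map_one τ) v
  have hcancel' : ∀ v : Y, τ ⟨w⁻¹ * x, hn'⟩ (τ ⟨x⁻¹ * w, hn⟩ v) = v := fun v ↦ by
    rw [rep_mul τ hn' hn (one_mem K) (by group)]
    exact LinearMap.congr_fun (map_one τ) v
  let A : TwistedHom ρ τ x →ₗ[ℂ] Representation.IntertwiningMap ρ (restrict hHK τ) :=
    { toFun T := LinearMap.intertwiningMap_of_isIntertwiningMap ρ (restrict hHK τ)
        (τ ⟨w⁻¹ * x, hn'⟩ ∘ₗ T.toLinearMap ∘ₗ θ.symm.toLinearMap) (by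
          rintro ⟨h, hh⟩ v
          obtain ⟨g, hg, hgw, hr, hρr, hτr⟩ := h2 h hh
          change τ ⟨w⁻¹ * x, hn'⟩ (T (θ.symm (ρ ⟨h, hh⟩ v))) =
            τ ⟨h, hHK hh⟩ (τ ⟨w⁻¹ * x, hn'⟩ (T (θ.symm v)))
          have e1 : ρ ⟨h, hh⟩ v = θ (ρ ⟨g, hg⟩ (θ.symm v)) := by
            rw [hθ g hg hgw, LinearEquiv.apply_symm_apply,
              ← rep_mul ρ hgw hr hh (mul_inv_cancel_left _ _), hρr, Module.End.one_apply]
          have e2 : ∀ y, τ ⟨h, hHK hh⟩ y = τ ⟨w⁻¹ * g * w, hHK hgw⟩ y := fun y ↦ by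
            rw [← rep_mul τ (hHK hgw) (hHK hr) (hHK hh) (mul_inv_cancel_left _ _), hτr,
              Module.End.one_apply]
          have hgx := hconj g (hHK hgw)
          rw [e1, LinearEquiv.symm_apply_apply, twistedHom_apply T hg hgx, e2,
            rep_mul τ hn' hgx (mul_mem hn' hgx) rfl, rep_mul τ (hHK hgw) hn' (mul_mem hn' hgx)
              (by group)])
      map_add' T T' := by
        ext v
        change τ _ ((T + T') (θ.symm v)) = τ _ (T (θ.symm v)) + τ _ (T' (θ.symm v))
        rw [← map_add]
        rfl
      map_smul' c T := by
        ext v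
        change τ _ ((c • T) (θ.symm v)) = c • τ _ (T (θ.symm v))
        rw [← map_smul]
        rfl }
  let B : Representation.IntertwiningMap ρ (restrict hHK τ) → TwistedHom ρ τ x := fun S ↦
    LinearMap.intertwiningMap_of_isIntertwiningMap _ _
      (τ ⟨x⁻¹ * w, hn⟩ ∘ₗ S.toLinearMap ∘ₗ θ.toLinearMap) (by
        rintro ⟨g, hg, hgx'⟩ v
        have hgx := mem_conj_iff.mp hgx'
        have hgw := h1 g hg (hconj' g hgx)
        change τ ⟨x⁻¹ * w, hn⟩ (S (θ (ρ ⟨g, hg⟩ v))) =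
          τ ⟨x⁻¹ * g * x, hgx⟩ (τ ⟨x⁻¹ * w, hn⟩ (S (θ v)))
        have e1 : ∀ u, S (ρ ⟨w⁻¹ * g * w, hgw⟩ u) = τ ⟨w⁻¹ * g * w, hHK hgw⟩ (S u) :=
          fun u ↦
            Representation.IntertwiningMap.isIntertwining _ _ S ⟨w⁻¹ * g * w, hgw⟩ u
        rw [hθ g hg hgw, e1, rep_mul τ hn (hHK hgw) (mul_mem hn (hHK hgw)) rfl,
          rep_mul τ hgx hn (mul_mem hn (hHK hgw)) (by group)])
  refine LinearEquiv.rank_eq (LinearEquiv.mk A B (fun T ↦ ?_) (fun S ↦ ?_))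
  · ext v
    change τ _ (τ _ (T (θ.symm (θ v)))) = T v
    rw [hcancel, LinearEquiv.symm_apply_apply]
  · ext v
    change τ _ (τ _ (S (θ (θ.symm v)))) = S v
    rw [hcancel', LinearEquiv.apply_symm_apply]

end Comparison

theorem inflate_eq_one {A : Type*} [Ring A] (𝔅 : Subring A) {X : Type*} [AddCommGroup X]
    [Module ℂ X] (π : Representation ℂ (U 𝔅 ⧸ U1 𝔅) X) {u : U 𝔅} (hu : u ∈ U1 𝔅) :
    inflate 𝔅 π u = 1 := by
  change π (QuotientGroup.mk' (U1 𝔅) u) = 1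
  rw [QuotientGroup.mk'_apply, (QuotientGroup.eq_one_iff u).mpr hu, map_one]

/-- The representation `ρ` does not depend, up to isomorphism, on the choice of the framing. -/
theorem exists_linearEquiv_tensorPower {Λ : LatticeChain E V} {f : ℕ} (φ φ' : Λ.Framing f)
    {W : Type*} [AddCommGroup W] [Module ℂ W] {ρ₀ : Representation ℂ (GL (Fin f) 𝓀[E]) W}
    {X : Type*} [AddCommGroup X] [Module ℂ X] {ρ : Representation ℂ (U Λ.order) X}
    (hρ : Nonempty (ρ.Equiv (Λ.inflateTensorPower φ ρ₀))) :
    ∃ ε : X ≃ₗ[ℂ] (⨂[ℂ] _ : Fin Λ.period, W), ∀ u v,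
      ε (ρ u v) = tensorPower ρ₀ Λ.period (Λ.reduction φ' u) (ε v) := by
  obtain ⟨P, hP⟩ := LatticeChain.exists_reduction_conj φ φ'
  obtain ⟨ε₀⟩ := hρ
  let A : (⨂[ℂ] _ : Fin Λ.period, W) ≃ₗ[ℂ] (⨂[ℂ] _ : Fin Λ.period, W) :=
    { tensorPower ρ₀ Λ.period P with
      invFun := tensorPower ρ₀ Λ.period P⁻¹
      left_inv v := by
        change tensorPower ρ₀ Λ.period P⁻¹ (tensorPower ρ₀ Λ.period P v) = v
        rw [← Module.End.mul_apply, ← map_mul, inv_mul_cancel, map_one, Module.End.one_apply]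
      right_inv v := by
        change tensorPower ρ₀ Λ.period P (tensorPower ρ₀ Λ.period P⁻¹ v) = v
        rw [← Module.End.mul_apply, ← map_mul, mul_inv_cancel, map_one, Module.End.one_apply] }
  refine ⟨ε₀.toLinearEquiv.trans A, fun u v ↦ ?_⟩
  have h1 : ε₀.toLinearEquiv (ρ u v)
      = tensorPower ρ₀ Λ.period (Λ.reduction φ u) (ε₀.toLinearEquiv v) :=
    Representation.IntertwiningMap.isIntertwining _ _ ε₀.toIntertwiningMap u v
  change tensorPower ρ₀ Λ.period P (ε₀.toLinearEquiv (ρ u v)) =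
    tensorPower ρ₀ Λ.period (Λ.reduction φ' u)
      (tensorPower ρ₀ Λ.period P (ε₀.toLinearEquiv v))
  rw [h1, hP, ← Module.End.mul_apply, ← Module.End.mul_apply, ← map_mul, ← map_mul,
    inv_mul_cancel_right]

theorem rank_twistedHom_inflate_eq [FiniteDimensional E V] {Λ₀ Λ : LatticeChain E V}
    (hle : Λ₀.order ≤ Λ.order) {f : ℕ} (φ : Λ₀.Framing f)
    {W : Type*} [AddCommGroup W] [Module ℂ W] {ρ₀ : Representation ℂ (GL (Fin f) 𝓀[E]) W}
    (hρ₀ : IsCuspidal ρ₀) {X : Type*} [AddCommGroup X] [Module ℂ X]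
    {ρ : Representation ℂ (U Λ₀.order) X}
    (hρ : Nonempty (ρ.Equiv (Λ₀.inflateTensorPower φ ρ₀)))
    {Y : Type*} [AddCommGroup Y] [Module ℂ Y]
    (τ : Representation ℂ (U Λ.order ⧸ U1 Λ.order) Y)
    {x : LinearMap.GeneralLinearGroup E V} (hx : x ∈ intertwiningSet ρ) :
    Module.rank ℂ (TwistedHom ρ (inflate Λ.order τ) x) =
      Module.rank ℂ (Representation.IntertwiningMap ρ
        (restrict (Submonoid.units_mono hle) (inflate Λ.order τ))) := by
  obtain ⟨b, β, hb, hbx⟩ := exists_adapted_basis Λ₀ φ x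
  -- realize `ρ` by the framing attached to the adapted basis `b`
  obtain ⟨ε, hε⟩ := exists_linearEquiv_tensorPower φ (LatticeChain.adaptedFraming hb) hρ
  have htriv : ∀ u : U Λ₀.order,
      Λ₀.IsRadical (((u : (Module.End E V)ˣ) : Module.End E V) - 1) → ρ u = 1 := by
    intro u hu
    refine LinearMap.ext fun v ↦ ε.injective ?_
    rw [hε, LatticeChain.reduction_eq_one _ hu, map_one]
    rfl
  -- by cuspidality, the relative position of the chain and its translate is a permutation
  obtain ⟨T, hT⟩ := hx
  have hβ := LatticeChain.degree_eq_of_intertwines hb hbx hρ₀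
    (T := T.toLinearMap ∘ₗ ε.symm.toLinearMap)
    (fun h ↦ hT (Representation.IntertwiningMap.ext (LinearMap.ext fun v ↦ by
      have := LinearMap.congr_fun h (ε v)
      simpa using this)))
    (fun n hn hrad y ↦ by
      have hnx := LatticeChain.mul_mem_U_of_isRadical hrad
      obtain ⟨v, rfl⟩ := ε.surjective y
      rw [← hε]
      change T (ε.symm (ε _)) = T (ε.symm (ε v))
      rw [LinearEquiv.symm_apply_apply, LinearEquiv.symm_apply_apply, twistedHom_apply T hn hnx,
        htriv ⟨_, hnx⟩ hrad]
      rfl)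
  obtain ⟨π, hπ, hbπ⟩ := LatticeChain.exists_permutation_of_degree_eq hbx hβ
  -- adjust the permutation to the blocks of the chain of `𝔅`
  obtain ⟨s, B, hc⟩ := LatticeChain.exists_isCoarsening hb hle
  obtain ⟨q, hq, hqπ, hsort⟩ := exists_sorted_permutation hπ hc.le_iff hc.map_add
  have hq' := symm_map_add hq
  let w : LinearMap.GeneralLinearGroup E V := permUnit b q.symm hq'
  let θ : X ≃ₗ[ℂ] X := ε.trans
    ((PiTensorProduct.reindex ℂ (fun _ ↦ W) (residuePerm q.symm hq').symm).trans ε.symm)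
  refine rank_twistedHom_eq (w := w) (Submonoid.units_mono hle) ρ _
    (hc.inv_mul_permUnit_mem hb hbπ hq hq' hqπ) ?_ ?_ θ ?_
  · intro g hg hgw
    refine LatticeChain.mem_U_of_mem_order (Λ' := Λ) ?_ (LatticeChain.mem_U_iff.mp hgw).2
    exact hc.conj_mem_order hb hq hq' hsort rfl (LatticeChain.mem_U_iff.mp hg).1
      (LatticeChain.mem_U_iff.mp hgw).1
  · intro h hh
    obtain ⟨g, hg, hgw, hrad⟩ := hc.exists_conj_mul hb hle hq hq' hsort (w := w) rfl hh
    refine ⟨g, hg, hgw, mul_mem (inv_mem hgw) hh, htriv _ (hc.isRadical hrad), ?_⟩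
    exact inflate_eq_one _ _ (LatticeChain.mem_U1_of_isRadical hrad)
  · intro g hg hgw v
    apply ε.injective
    have h1 : ∀ u, ε (θ u)
        = PiTensorProduct.reindex ℂ (fun _ ↦ W) (residuePerm q.symm hq').symm (ε u) :=
      fun u ↦ ε.apply_symm_apply _
    rw [hε, h1, h1, hε, reindex_tensorPower,
      LatticeChain.reduction_conj_permUnit hb hq hq' rfl hg hgw]

end HereditaryOrder

end

theorem mainTheorem3
    {E : Type*} [Field E] [ValuativeRel E] [TopologicalSpace E] [IsNonarchimedeanLocalField E]
    {V : Type*} [AddCommGroup V] [Module E V] [FiniteDimensional E V]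
    -- the principal order `𝔅₀ = End⁰(L₀)`, with bases of the quotients of its lattice chain
    (Λ₀ : HereditaryOrder.LatticeChain E V) (f : ℕ) (φ : Λ₀.Framing f)
    -- the hereditary order `𝔅`
    (𝔅 : Subring (Module.End E V)) (h𝔅 : HereditaryOrder.IsHereditaryOrder 𝔅)
    (hle : Λ₀.order ≤ 𝔅)
    -- the cuspidal representation `ρ₀`
    {W : Type*} [AddCommGroup W] [Module ℂ W]
    (ρ₀ : Representation ℂ (Matrix.GeneralLinearGroup (Fin f) 𝓀[E]) W)
    (hρ₀ : HereditaryOrder.IsCuspidal ρ₀)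
    -- the representation `ρ`
    {X : Type*} [AddCommGroup X] [Module ℂ X]
    (ρ : Representation ℂ (HereditaryOrder.U Λ₀.order) X)
    (hρ : Nonempty (ρ.Equiv (Λ₀.inflateTensorPower φ ρ₀)))
    -- the representation `τ`
    {Y : Type*} [AddCommGroup Y] [Module ℂ Y]
    (τ : Representation ℂ (HereditaryOrder.U 𝔅 ⧸ HereditaryOrder.U1 𝔅) Y)
    (hτ : τ.IsIrreducible)
    (x : LinearMap.GeneralLinearGroup E V)
    (hx : x ∈ HereditaryOrder.intertwiningSet ρ) :
    Module.rank ℂ (HereditaryOrder.TwistedHom ρ (HereditaryOrder.inflate 𝔅 τ) x) =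
      Module.rank ℂ (Representation.IntertwiningMap ρ
        (HereditaryOrder.restrict (Submonoid.units_mono hle)
          (HereditaryOrder.inflate 𝔅 τ))) := by
  obtain ⟨Λ, rfl⟩ := h𝔅
  exact HereditaryOrder.rank_twistedHom_inflate_eq hle φ hρ₀ hρ τ hx
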